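/- Let $K$ be an imaginary quadratic field, viewed inside $\mathbb{C}$ by a fixed embedding, with ring of integers $\mathcal{O}$ and discriminant $\Delta$, and let $\widehat{K}=K\cup\{\infty\}$ inside the extended complex plane $\widehat{\mathbb{C}}$. An oriented circle $C$ is given by $\zeta\in\mathbb{C}$ and $r,\hat r\in\mathbb{R}$ (its curvature-center, curvature and cocurvature) with $|\zeta|^2-\hat r r=1$. Its points are the $\alpha/\beta\in\widehat{\mathbb{C}}$ with $r|\alpha|^2-2\,\mathrm{Re}(\overline{\alpha}\beta\zeta)+\hat r|\beta|^2=0$; replacing $(\zeta,r,\hat r)$ by its negative reverses the orientation. For a real number $D>0$ let $\mathcal{S}_D$ be the set of oriented circles for which $i\sqrt{D}\,[\zeta\;\;\overline{\zeta}\;\;\hat r\;\;r]\in\mathcal{O}^2\times\sqrt{\Delta}\,\mathbb{Z}^2$. A set $\mathcal{A}$ of oriented circles is finitely connected if there is $n\in\mathbb{N}$ such that every $C\in\mathcal{A}$ of curvature $r\neq 0$ has a chain $C=C_0,C_1,\dots,C_n\in\mathcal{A}$ (repetitions allowed) in which $C_{k-1}$ and $C_k$ have a common point in $\widehat{\mathbb{C}}$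 for all $1\le k\le n$ and the curvature of $C_n$ has magnitude at most $|r|/2$. Theorem. Suppose that $D>0$ and that $\mathcal{S}_D$ is nonempty and finitely connected. Then every point of $\widehat{K}$ lies on a circle of $\mathcal{S}_D$. Moreover $D$ is an integer, the class group of $K$ is generated by the classes of the prime ideals of $\mathcal{O}$ whose norm divides $D\Delta$, and every ideal class in the principal genus contains an integral ideal of norm $D$. (The principal genus consists of the ideal classes that contain an integral ideal of norm prime to $\Delta$ and congruent modulo $\Delta$ to the norm of an element of $\mathcal{O}$.) -/

import Mathlib

open NumberField
open scoped nonZeroDivisors ComplexConjugate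

noncomputable section

/-- An oriented circle in the extended complex plane, given by its curvature-center `ζ`, its
curvature `r` and its cocurvature `rhat`, subject to `|ζ|² - rhat * r = 1`. The triple determines
the circle and its orientation, and is determined by them: the opposite triple is the same circle
with the opposite orientation. -/
@[ext]
structure OrientedCircle where
  ζ : ℂ
  r : ℝ
  rhat : ℝ
  unit : Complex.normSq ζ - rhat * r = 1

namespace OrientedCircle

/-- The vector `[ζ, conj ζ, rhat, r]`. -/
def vec (C : OrientedCircle) : Fin 4 → ℂ :=
  ![C.ζ, conj C.ζ, (C.rhat : ℂ), (C.r : ℂ)]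

/-- The Hermitian form whose zeros `(α, β) ≠ 0` are the homogeneous coordinates of the points
`α / β` of the circle. -/
def form (C : OrientedCircle) (α β : ℂ) : ℝ :=
  C.r * Complex.normSq α - 2 * (conj α * β * C.ζ).re + C.rhat * Complex.normSq β

/-- The points of the circle in the extended complex plane: `z = z / 1` and `∞ = 1 / 0`. -/
def points (C : OrientedCircle) : Set (OnePoint ℂ) :=
  {x | (∃ z : ℂ, x = (z : OnePoint ℂ) ∧ C.form z 1 = 0) ∨ (x = OnePoint.infty ∧ C.form 1 0 = 0)}

end OrientedCircle

/-- A set of oriented circles covers a point if the point lies on one of the circles. -/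
def Covers (A : Set OrientedCircle) (x : OnePoint ℂ) : Prop :=
  ∃ C ∈ A, x ∈ C.points

/-- There is one `n` such that every circle of `A` of nonzero curvature `r` starts a chain
`C₀, …, Cₙ` in `A` whose consecutive members meet and whose last member has curvature of magnitude
at most `|r| / 2`. -/
def FinitelyConnected (A : Set OrientedCircle) : Prop :=
  ∃ n : ℕ, ∀ C ∈ A, C.r ≠ 0 →
    ∃ c : Fin (n + 1) → OrientedCircle,
      c 0 = C ∧ (∀ k, c k ∈ A) ∧
      (∀ k : Fin n, ((c k.castSucc).points ∩ (c k.succ).points).Nonempty) ∧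
      |(c (Fin.last n)).r| ≤ |C.r| / 2

section Field

variable {K : Type*} [Field K] [NumberField K]

/-- The points of `K`, embedded in `ℂ` by `σ`, together with the point at infinity. -/
def extendedField (σ : K →+* ℂ) : Set (OnePoint ℂ) :=
  insert OnePoint.infty (Set.range fun a : K => ((σ a : ℂ) : OnePoint ℂ))

/-- The square root of the discriminant of an imaginary quadratic field (which is negative). -/
def sqrtDiscr (K : Type*) [Field K] [NumberField K] : ℂ :=
  Complex.I * (Real.sqrt (-(discr K : ℝ)) : ℂ)

/-- The lattice `𝓞² × √Δ ℤ²` in `ℂ⁴`. -/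
def circleLattice (σ : K →+* ℂ) : Set (Fin 4 → ℂ) :=
  {v | (∃ a : 𝓞 K, v 0 = σ a) ∧ (∃ b : 𝓞 K, v 1 = σ b) ∧
    (∃ s : ℤ, v 2 = sqrtDiscr K * s) ∧ (∃ t : ℤ, v 3 = sqrtDiscr K * t)}

/-- For `D > 0`, the arrangement `S_D` of all oriented circles `C` for which `i √D` times the
vector of `C` lies in `𝓞² × √Δ ℤ²`. -/
def arrangement (σ : K →+* ℂ) (D : ℝ) : Set OrientedCircle :=
  {C | (Complex.I * (Real.sqrt D : ℂ)) • C.vec ∈ circleLattice σ}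

/-- The principal genus, in Gauss's sense: the ideal classes that contain an integral ideal whose
norm is prime to the discriminant `Δ` and congruent modulo `Δ` to the norm of an algebraic integer
of `K`, that is, to a value of the principal form. For a given class the residues modulo `Δ` of
the norms of such ideals form a single coset of the group of invertible residues of norms of
integers, so the choice of the ideal does not matter. -/
def principalGenus (K : Type*) [Field K] [NumberField K] : Set (ClassGroup (𝓞 K)) :=
  {c | ∃ I : (Ideal (𝓞 K))⁰, ClassGroup.mk0 I = c ∧
    IsCoprime (Ideal.absNorm (I : Ideal (𝓞 K)) : ℤ) (discr K) ∧
    ∃ x : 𝓞 K, (Ideal.absNorm (I : Ideal (𝓞 K)) : ℤ) ≡ Algebra.norm ℤ x [ZMOD discr K]}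

/-- The ideal classes of the nonzero prime ideals whose norm divides `m`. -/
def primeClasses (K : Type*) [Field K] [NumberField K] (m : ℤ) : Set (ClassGroup (𝓞 K)) :=
  {c | ∃ P : (Ideal (𝓞 K))⁰, (P : Ideal (𝓞 K)).IsPrime ∧
    (Ideal.absNorm (P : Ideal (𝓞 K)) : ℤ) ∣ m ∧ ClassGroup.mk0 P = c}

end Field

end

section Quadratic

variable {K : Type*} [Field K] [NumberField K]

/-- Complex conjugation on the integers of an imaginary quadratic field, together with the square
root `δ` of the discriminant and the arithmetic facts about them. -/
structure ConjData (σ : K →+* ℂ) where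
  τ : 𝓞 K ≃+* 𝓞 K
  map_τ : ∀ x : 𝓞 K, σ (τ x) = conj (σ x)
  norm_eq : ∀ x : 𝓞 K, ((Algebra.norm ℤ x : ℤ) : 𝓞 K) = x * τ x
  δ : 𝓞 K
  map_δ : σ δ = sqrtDiscr K
  sub_conj : ∀ u : 𝓞 K, ∃ k : ℤ, u - τ u = k * δ
  mem_of_sub_mem : ∀ I : Ideal (𝓞 K), (∀ u, u - τ u ∈ I) → δ ∈ I
  discr_neg : discr K < 0
  discr_basis : ∀ b : Module.Basis (Fin 2) ℤ (𝓞 K),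
    (b 0 * τ (b 1) - τ (b 0) * b 1) ^ 2 = ((discr K : ℤ) : 𝓞 K)

theorem embedding_injective {K : Type*} [Field K] (σ : K →+* ℂ) {x y : 𝓞 K} (h : σ x = σ y) :
    x = y :=
  RingOfIntegers.ext (σ.injective h)

theorem exists_conj (hquad : Module.finrank ℚ K = 2) (himag : IsTotallyComplex K) (σ : K →+* ℂ) :
    ∃ τ : 𝓞 K ≃+* 𝓞 K, (∀ x : 𝓞 K, σ (τ x) = conj (σ x)) ∧
      (∀ x : 𝓞 K, ((Algebra.norm ℤ x : ℤ) : 𝓞 K) = x * τ x) ∧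
      (∀ x : 𝓞 K, ((Algebra.trace ℤ (𝓞 K) x : ℤ) : 𝓞 K) = x + τ x) := by
  have : Algebra.IsQuadraticExtension ℚ K := ⟨hquad⟩
  have : IsAbelianGalois ℚ K :=
    { (inferInstance : IsMulCommutative Gal(K/ℚ)) with }
  have : IsCMField K := IsCMField.of_isAbelianGalois K
  classical
  let T : Gal(K/ℚ) := AlgEquiv.ofRingEquiv (f := (IsCMField.complexConj K).toRingEquiv)
    (fun x => by simp)
  have hT : ∀ x, T x = IsCMField.complexConj K x := fun x => rfl
  have hT1 : (1 : Gal(K/ℚ)) ≠ T := by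
    intro h
    apply IsCMField.complexConj_ne_one K
    ext x
    rw [← hT, ← h]
    rfl
  have huniv : (Finset.univ : Finset Gal(K/ℚ)) = {1, T} := by
    symm
    apply Finset.eq_univ_of_card
    rw [Finset.card_pair hT1, ← Nat.card_eq_fintype_card, IsGalois.card_aut_eq_finrank, hquad]
  refine ⟨(IsCMField.ringOfIntegersComplexConj K).toRingEquiv, fun x => ?_, fun x => ?_,
    fun x => ?_⟩
  · exact IsCMField.complexEmbedding_complexConj K σ x
  · apply RingOfIntegers.ext
    have h := Algebra.norm_eq_prod_automorphisms ℚ (x : K)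
    rw [huniv, Finset.prod_pair hT1, ← Algebra.coe_norm_int] at h
    rw [eq_ratCast, Rat.cast_intCast] at h
    exact (map_intCast (algebraMap (𝓞 K) K) _).trans h
  · apply RingOfIntegers.ext
    have h := trace_eq_sum_automorphisms (K := ℚ) (x : K)
    rw [huniv, Finset.sum_pair hT1, ← Algebra.coe_trace_int] at h
    rw [eq_ratCast, Rat.cast_intCast] at h
    exact (map_intCast (algebraMap (𝓞 K) K) _).trans h

theorem nonempty_conjData (hquad : Module.finrank ℚ K = 2) (himag : IsTotallyComplex K)
    (σ : K →+* ℂ) : Nonempty (ConjData σ) := by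
  obtain ⟨τ, hτ, hnorm, htr⟩ := exists_conj hquad himag σ
  have hinj : ∀ {x y : 𝓞 K}, σ x = σ y → x = y := fun h =>
    RingOfIntegers.ext (σ.injective h)
  have hττ : ∀ x, τ (τ x) = x := fun x => hinj (by simp [hτ])
  have hrank : Module.finrank ℤ (𝓞 K) = 2 := by rw [RingOfIntegers.rank, hquad]
  have hbasis : ∀ b : Module.Basis (Fin 2) ℤ (𝓞 K),
      (b 0 * τ (b 1) - τ (b 0) * b 1) ^ 2 = ((discr K : ℤ) : 𝓞 K) := by
    intro b
    rw [← discr_eq_discr K b, Algebra.discr_def, Matrix.det_fin_two]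
    simp only [Algebra.traceMatrix_apply, Algebra.traceForm_apply]
    push_cast
    simp only [htr, map_mul]
    ring
  let b := Module.finBasisOfFinrankEq ℤ (𝓞 K) hrank
  set d : 𝓞 K := b 0 * τ (b 1) - τ (b 0) * b 1 with hd
  have hτd : τ d = -d := by simp only [hd, map_sub, map_mul, hττ]; ring
  have hd2 : d ^ 2 = ((discr K : ℤ) : 𝓞 K) := hbasis b
  have hσd2 : (σ d) ^ 2 = ((discr K : ℝ) : ℂ) := by
    have := congrArg (fun x : 𝓞 K => σ x) hd2
    simpa using this
  have hre : (σ d).re = 0 := by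
    have := hτ d
    rw [hτd] at this
    have := congrArg Complex.re this
    simp at this
    linarith
  have him : -((σ d).im ^ 2) = (discr K : ℝ) := by
    have := congrArg Complex.re hσd2
    rw [pow_two, Complex.mul_re, hre, Complex.ofReal_re] at this
    linarith
  have hneg : discr K < 0 := by
    have h0 : discr K ≠ 0 := discr_ne_zero K
    have : (discr K : ℝ) ≤ 0 := by nlinarith [sq_nonneg (σ d).im]
    have : discr K ≤ 0 := by exact_mod_cast this
    omega
  have hdiff : ∀ u : 𝓞 K, ∃ k : ℤ, u - τ u = k * d := by
    intro u
    have hu := b.sum_repr u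
    have h1 := b.sum_repr 1
    rw [Fin.sum_univ_two] at hu h1
    simp only [zsmul_eq_mul] at hu h1
    refine ⟨b.repr u 0 * b.repr 1 1 - b.repr u 1 * b.repr 1 0, ?_⟩
    have h1' := congrArg τ h1
    have hu' := congrArg τ hu
    simp only [map_add, map_mul, map_intCast, map_one] at h1' hu'
    push_cast
    linear_combination (-((b.repr 1 0 : 𝓞 K) * τ (b 0) + (b.repr 1 1 : 𝓞 K) * τ (b 1))) * hu
      - u * h1' + ((b.repr 1 0 : 𝓞 K) * b 0 + (b.repr 1 1 : 𝓞 K) * b 1) * hu' + τ u * h1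
  have hmem : ∀ I : Ideal (𝓞 K), (∀ u, u - τ u ∈ I) → d ∈ I := by
    intro I hI
    have : d = b 1 * (b 0 - τ (b 0)) - b 0 * (b 1 - τ (b 1)) := by rw [hd]; ring
    rw [this]
    exact I.sub_mem (I.mul_mem_left _ (hI _)) (I.mul_mem_left _ (hI _))
  have hsq : Real.sqrt (-(discr K : ℝ)) = |(σ d).im| := by
    rw [← him, neg_neg, Real.sqrt_sq_eq_abs]
  have hσd : σ d = Complex.I * ((σ d).im : ℂ) := by
    apply Complex.ext <;> simp [hre]
  rcases le_total 0 (σ d).im with h | h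
  · refine ⟨⟨τ, hτ, hnorm, d, ?_, hdiff, hmem, hneg, hbasis⟩⟩
    rw [sqrtDiscr, hsq, abs_of_nonneg h, ← hσd]
  · refine ⟨⟨τ, hτ, hnorm, -d, ?_, fun u => ?_, fun I hI => I.neg_mem (hmem I hI), hneg, hbasis⟩⟩
    · rw [sqrtDiscr, hsq, abs_of_nonpos h]
      simp only [map_neg, Complex.ofReal_neg, mul_neg]
      rw [← hσd]
    · obtain ⟨k, hk⟩ := hdiff u
      exact ⟨-k, by rw [hk]; push_cast; ring⟩

namespace ConjData

variable {σ : K →+* ℂ} (c : ConjData σ)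

@[simp]
theorem τ_τ (x : 𝓞 K) : c.τ (c.τ x) = x :=
  embedding_injective σ (by rw [c.map_τ, c.map_τ, Complex.conj_conj])

theorem τ_intCast (k : ℤ) : c.τ k = k := map_intCast c.τ k

theorem conj_sqrtDiscr : conj (sqrtDiscr K) = -sqrtDiscr K := by
  simp [sqrtDiscr]

@[simp]
theorem τ_δ : c.τ c.δ = -c.δ :=
  embedding_injective σ (by
    rw [c.map_τ, c.map_δ, conj_sqrtDiscr, ← c.map_δ]
    exact (map_neg σ _).symm)

theorem discr_neg_real (c : ConjData σ) : (discr K : ℝ) < 0 := by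
  exact_mod_cast c.discr_neg

theorem sqrtDiscr_sq (c : ConjData σ) : (sqrtDiscr K) ^ 2 = (discr K : ℂ) := by
  have h := c.discr_neg_real
  rw [sqrtDiscr, mul_pow, Complex.I_sq, ← Complex.ofReal_pow, Real.sq_sqrt (by linarith)]
  push_cast
  ring

theorem δ_sq : c.δ ^ 2 = ((discr K : ℤ) : 𝓞 K) :=
  embedding_injective σ (by
    have := c.sqrtDiscr_sq
    rw [← c.map_δ] at this
    simpa using this)

theorem δ_ne_zero : c.δ ≠ 0 := by
  intro h
  have := c.δ_sq
  rw [h] at this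
  rw [zero_pow two_ne_zero] at this
  exact discr_ne_zero K (by exact_mod_cast this.symm)

theorem norm_eq_normSq (c : ConjData σ) (x : 𝓞 K) : ((Algebra.norm ℤ x : ℤ) : ℝ) = Complex.normSq (σ x) := by
  have h := congrArg (fun y : 𝓞 K => σ y) (c.norm_eq x)
  have h2 : (((Algebra.norm ℤ x : ℤ) : ℝ) : ℂ) = ((Complex.normSq (σ x) : ℝ) : ℂ) := by
    rw [← Complex.mul_conj, ← c.map_τ]
    simpa using h
  exact_mod_cast h2

theorem norm_nonneg (c : ConjData σ) (x : 𝓞 K) : 0 ≤ Algebra.norm ℤ x := by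
  have h := c.norm_eq_normSq x
  have h2 := Complex.normSq_nonneg (σ x)
  rw [← h] at h2
  exact_mod_cast h2

theorem absNorm_span (c : ConjData σ) (x : 𝓞 K) :
    ((Ideal.absNorm (Ideal.span {x}) : ℕ) : ℤ) = Algebra.norm ℤ x := by
  rw [Ideal.absNorm_span_singleton, Int.natCast_natAbs, abs_of_nonneg (c.norm_nonneg x)]

/-- The conjugate of an ideal. -/
def bar (I : Ideal (𝓞 K)) : Ideal (𝓞 K) := I.map c.τ

theorem mem_bar {I : Ideal (𝓞 K)} {x : 𝓞 K} : x ∈ c.bar I ↔ c.τ x ∈ I := by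
  rw [bar, Ideal.mem_map_iff_of_surjective _ c.τ.surjective]
  constructor
  · rintro ⟨y, hy, rfl⟩
    simpa using hy
  · intro h
    exact ⟨_, h, by simp⟩

theorem bar_mul (I J : Ideal (𝓞 K)) : c.bar (I * J) = c.bar I * c.bar J := Ideal.map_mul _ _ _

theorem bar_sup (I J : Ideal (𝓞 K)) : c.bar (I ⊔ J) = c.bar I ⊔ c.bar J := Ideal.map_sup _ _ _

theorem bar_span (s : Set (𝓞 K)) : c.bar (Ideal.span s) = Ideal.span (c.τ '' s) :=
  Ideal.map_span _ _

theorem bar_span_singleton (x : 𝓞 K) : c.bar (Ideal.span {x}) = Ideal.span {c.τ x} := by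
  rw [bar_span, Set.image_singleton]

@[simp]
theorem bar_bar (I : Ideal (𝓞 K)) : c.bar (c.bar I) = I := by
  ext x
  rw [mem_bar, mem_bar, τ_τ]

theorem bar_ne_bot {I : Ideal (𝓞 K)} (h : I ≠ ⊥) : c.bar I ≠ ⊥ := by
  intro h2
  apply h
  rw [← c.bar_bar I, h2]
  exact Ideal.map_bot

theorem absNorm_bar (I : Ideal (𝓞 K)) : Ideal.absNorm (c.bar I) = Ideal.absNorm I := by
  have h : Ideal.relNorm ℤ (c.bar I) = Ideal.relNorm ℤ I :=
    Ideal.relNorm_map_algEquiv (AlgEquiv.ofRingEquiv (R := ℤ) (f := c.τ) fun k => by simp) I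
  rw [Ideal.relNorm_int, Ideal.relNorm_int, Ideal.span_singleton_eq_span_singleton] at h
  simpa using Int.associated_iff_natAbs.mp h

theorem mul_bar (I : Ideal (𝓞 K)) :
    I * c.bar I = Ideal.span {((Ideal.absNorm I : ℕ) : 𝓞 K)} := by
  rcases eq_or_ne I ⊥ with rfl | hI
  · simp
  have hle : Ideal.span {((Ideal.absNorm I : ℕ) : 𝓞 K)} ≤ I * c.bar I := by
    rw [Ideal.span_singleton_le_iff_mem]
    have h1 : ((Ideal.absNorm I : ℕ) : ℤ) ∈ Ideal.relNorm ℤ I := by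
      rw [Ideal.relNorm_int]
      exact Ideal.mem_span_singleton_self _
    have h2 : Ideal.relNorm ℤ I ≤ (I * c.bar I).comap (algebraMap ℤ (𝓞 K)) := by
      rw [← Ideal.spanNorm_eq, Ideal.spanNorm, Ideal.map, Ideal.span_le]
      rintro _ ⟨x, hx, rfl⟩
      rw [SetLike.mem_coe, Ideal.mem_comap, Algebra.intNorm_eq_norm]
      have h3 := Ideal.mul_mem_mul hx (c.mem_bar.mpr (by rwa [c.τ_τ] : c.τ (c.τ x) ∈ I))
      rw [← c.norm_eq] at h3
      simpa using h3
    simpa using h2 h1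
  obtain ⟨Q, hQ⟩ := Ideal.dvd_iff_le.mpr hle
  have hn : Ideal.absNorm (Ideal.span {((Ideal.absNorm I : ℕ) : 𝓞 K)}) = Ideal.absNorm I ^ 2 := by
    have h := c.absNorm_span ((Ideal.absNorm I : ℕ) : 𝓞 K)
    have h2 := c.norm_eq ((Ideal.absNorm I : ℕ) : 𝓞 K)
    rw [map_natCast c.τ, ← h] at h2
    have h3 : Ideal.absNorm (Ideal.span {((Ideal.absNorm I : ℕ) : 𝓞 K)}) =
      Ideal.absNorm I * Ideal.absNorm I := by exact_mod_cast h2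
    rw [h3, sq]
  have h0 : Ideal.absNorm I ≠ 0 := by rwa [Ne, Ideal.absNorm_eq_zero_iff]
  have hm := congrArg Ideal.absNorm hQ
  rw [hn, map_mul, map_mul, absNorm_bar, ← sq] at hm
  have hQ1 : Ideal.absNorm Q = 1 := by
    have h2 : 0 < Ideal.absNorm I ^ 2 := by positivity
    nlinarith
  rw [Ideal.absNorm_eq_one_iff] at hQ1
  rw [hQ, hQ1, Ideal.mul_top]

end ConjData

end Quadratic

section Classes

variable {K : Type*} [Field K] [NumberField K]

/-- The class of a nonzero ideal. -/
noncomputable def idealClass (I : Ideal (𝓞 K)) (hI : I ≠ ⊥) : ClassGroup (𝓞 K) :=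
  ClassGroup.mk0 ⟨I, mem_nonZeroDivisors_of_ne_zero hI⟩

theorem idealClass_mul {I J : Ideal (𝓞 K)} (hI : I ≠ ⊥) (hJ : J ≠ ⊥) (hIJ : I * J ≠ ⊥) :
    idealClass (I * J) hIJ = idealClass I hI * idealClass J hJ := by
  rw [idealClass, idealClass, idealClass, ← map_mul]
  rfl

theorem exists_idealClass_eq (k : ClassGroup (𝓞 K)) : ∃ I, ∃ hI : I ≠ ⊥, idealClass I hI = k := by
  obtain ⟨I, rfl⟩ := ClassGroup.mk0_surjective k
  exact ⟨I, nonZeroDivisors.coe_ne_zero I, rfl⟩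

theorem idealClass_eq_iff {I J : Ideal (𝓞 K)} (hI : I ≠ ⊥) (hJ : J ≠ ⊥) :
    idealClass I hI = idealClass J hJ ↔
      ∃ x y : 𝓞 K, x ≠ 0 ∧ y ≠ 0 ∧ Ideal.span {x} * I = Ideal.span {y} * J := by
  rw [idealClass, idealClass, ClassGroup.mk0_eq_mk0_iff]
  constructor
  · rintro ⟨x, y, hx, hy, h⟩
    exact ⟨x, y, hx, hy, h⟩
  · rintro ⟨x, y, hx, hy, h⟩
    exact ⟨x, y, hx, hy, h⟩

theorem idealClass_span {x : 𝓞 K} (hx : Ideal.span {x} ≠ ⊥) : idealClass (Ideal.span {x}) hx = 1 := by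
  rw [idealClass, ClassGroup.mk0_eq_one_iff]
  exact ⟨⟨x, rfl⟩⟩

theorem idealClass_congr {I J : Ideal (𝓞 K)} (h : I = J) (hI : I ≠ ⊥) (hJ : J ≠ ⊥) :
    idealClass I hI = idealClass J hJ := by
  subst h; rfl

theorem absNorm_cast_ne_zero {I : Ideal (𝓞 K)} (hI : I ≠ ⊥) :
    ((Ideal.absNorm I : ℕ) : 𝓞 K) ≠ 0 := by
  have h : Ideal.absNorm I ≠ 0 := by rwa [Ne, Ideal.absNorm_eq_zero_iff]
  exact_mod_cast h

theorem eq_of_le_of_absNorm_eq {I J : Ideal (𝓞 K)} (hI : I ≠ ⊥) (h : I ≤ J)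
    (hN : Ideal.absNorm I = Ideal.absNorm J) : I = J := by
  obtain ⟨Q, rfl⟩ := Ideal.dvd_iff_le.mpr h
  have hJ : Ideal.absNorm J ≠ 0 := by
    rw [Ne, Ideal.absNorm_eq_zero_iff]
    exact left_ne_zero_of_mul hI
  rw [map_mul] at hN
  have hQ : Ideal.absNorm Q = 1 := (mul_eq_left₀ hJ).mp hN
  rw [Ideal.absNorm_eq_one_iff] at hQ
  rw [hQ, Ideal.mul_top]

theorem absNorm_pos {I : Ideal (𝓞 K)} (hI : I ≠ ⊥) : 0 < Ideal.absNorm I :=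
  Nat.pos_of_ne_zero (by rwa [Ne, Ideal.absNorm_eq_zero_iff])

theorem idealClass_mem_closure_of_absNorm_dvd (m : ℤ) (I : Ideal (𝓞 K)) (hI : I ≠ ⊥)
    (h : ((Ideal.absNorm I : ℕ) : ℤ) ∣ m) :
    idealClass I hI ∈ Subgroup.closure (primeClasses K m) := by
  induction I using UniqueFactorizationMonoid.induction_on_prime with
  | h₁ => exact absurd rfl hI
  | h₂ x hx =>
    rw [Ideal.isUnit_iff] at hx
    rw [idealClass_congr (hx.trans Ideal.span_singleton_one.symm) hI (by simp), idealClass_span]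
    exact one_mem _
  | h₃ I P hI0 hP ih =>
    have hP0 : P ≠ ⊥ := hP.ne_zero
    rw [idealClass_mul hP0 hI0]
    rw [map_mul, Nat.cast_mul] at h
    refine mul_mem (Subgroup.subset_closure ?_) (ih hI0 ((Dvd.intro_left _ rfl).trans h))
    exact ⟨⟨P, mem_nonZeroDivisors_of_ne_zero hP0⟩, Ideal.isPrime_of_prime hP,
      (Dvd.intro _ rfl).trans h, rfl⟩

namespace ConjData

variable {σ : K →+* ℂ} (c : ConjData σ)

theorem τ_ne_zero {x : 𝓞 K} (hx : x ≠ 0) : c.τ x ≠ 0 := by simpa using hx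

theorem idealClass_bar {I : Ideal (𝓞 K)} (hI : I ≠ ⊥) :
    idealClass (c.bar I) (c.bar_ne_bot hI) = (idealClass I hI)⁻¹ := by
  have h0 : I * c.bar I ≠ ⊥ := mul_ne_zero hI (c.bar_ne_bot hI)
  have h : Ideal.span {((Ideal.absNorm I : ℕ) : 𝓞 K)} ≠ ⊥ := by rwa [← c.mul_bar I]
  rw [eq_inv_iff_mul_eq_one, mul_comm, ← idealClass_mul hI _ h0,
    idealClass_congr (c.mul_bar I) h0 h, idealClass_span]

theorem norm_δ : Algebra.norm ℤ c.δ = -discr K := by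
  have h := c.norm_eq c.δ
  rw [c.τ_δ, mul_neg, ← sq, c.δ_sq] at h
  exact_mod_cast h

/-- A prime ideal equal to its conjugate is inert, hence principal, or ramified. -/
theorem prime_of_bar_eq {P : Ideal (𝓞 K)} (hP : P.IsPrime) (hP0 : P ≠ ⊥) (h : c.bar P = P) :
    idealClass P hP0 = 1 ∨ ((Ideal.absNorm P : ℕ) : ℤ) ∣ discr K := by
  by_cases hall : ∀ u, u - c.τ u ∈ P
  · right
    have hδ := c.mem_of_sub_mem P hall
    have h1 := Ideal.absNorm_dvd_norm_of_mem hδ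
    rwa [c.norm_δ, dvd_neg] at h1
  left
  push Not at hall
  obtain ⟨u, hu⟩ := hall
  obtain ⟨p, hp, hpP⟩ : ∃ p : ℕ, p.Prime ∧ (p : 𝓞 K) ∈ P := by
    have h1 : ((Ideal.absNorm P : ℕ) : 𝓞 K) ∈ P := Ideal.absNorm_mem P
    generalize hN : Ideal.absNorm P = N at h1
    have hN0 : N ≠ 0 := hN ▸ (absNorm_pos hP0).ne'
    clear hN
    induction N using Nat.recOnMul with
    | zero => exact absurd rfl hN0
    | one => exact absurd ((Ideal.eq_top_iff_one P).mpr (by simpa using h1)) hP.ne_top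
    | prime p hp => exact ⟨p, hp, h1⟩
    | mul a b iha ihb =>
      rw [Nat.cast_mul] at h1
      rcases hP.mem_or_mem h1 with h2 | h2
      · exact iha h2 (left_ne_zero_of_mul hN0)
      · exact ihb h2 (right_ne_zero_of_mul hN0)
  have hpn : Algebra.norm ℤ (p : 𝓞 K) = p ^ 2 := by
    have h2 := c.norm_eq (p : 𝓞 K)
    rw [map_natCast c.τ, ← sq] at h2
    exact_mod_cast h2
  have hdvd := Ideal.absNorm_dvd_norm_of_mem hpP
  rw [hpn] at hdvd
  have hdvd' : Ideal.absNorm P ∣ p ^ 2 := by exact_mod_cast hdvd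
  obtain ⟨k, hk, hkP⟩ := (Nat.dvd_prime_pow hp).mp hdvd'
  interval_cases k
  · rw [pow_zero, Ideal.absNorm_eq_one_iff] at hkP
    exact absurd hkP hP.ne_top
  · exfalso
    apply hu
    have hcard : Nat.card (𝓞 K ⧸ P) = p := by
      rw [← pow_one p, ← hkP]; rfl
    have : Fact p.Prime := ⟨hp⟩
    have h1 : (1 : 𝓞 K ⧸ P) ≠ 0 := by
      rw [← map_one (Ideal.Quotient.mk P), Ne, Ideal.Quotient.eq_zero_iff_mem,
        ← Ideal.eq_top_iff_one]
      exact hP.ne_top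
    obtain ⟨k, hk⟩ := AddSubgroup.mem_zmultiples_iff.mp
      (mem_zmultiples_of_prime_card hcard h1 (g' := Ideal.Quotient.mk P u))
    have h2 : u - k ∈ P := by
      rw [← Ideal.Quotient.eq_zero_iff_mem, map_sub, map_intCast, ← hk]
      simp
    have h3 : c.τ u - k ∈ P := by
      rw [← h, c.mem_bar]
      simpa using h2
    simpa using P.sub_mem h2 h3
  · have hp0 : Ideal.span {(p : 𝓞 K)} ≠ ⊥ := by simpa using hp.ne_zero
    have h1 : Ideal.absNorm (Ideal.span {(p : 𝓞 K)}) = Ideal.absNorm P := by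
      have := c.absNorm_span (p : 𝓞 K)
      rw [hpn] at this
      rw [hkP]
      exact_mod_cast this
    have h2 := (eq_of_le_of_absNorm_eq hp0
      ((Ideal.span_singleton_le_iff_mem P).mpr hpP) h1).symm
    rw [idealClass_congr h2 hP0 (h2 ▸ hP0), idealClass_span]

theorem idealClass_mem_of_bar_eq (n : ℤ) (I : Ideal (𝓞 K)) (hI : I ≠ ⊥) (h : c.bar I = I) :
    idealClass I hI ∈ Subgroup.closure (primeClasses K (n * discr K)) := by
  induction hN : Ideal.absNorm I using Nat.strong_induction_on generalizing I with
  | _ N ih =>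
  by_cases htop : I = ⊤
  · rw [idealClass_congr (htop.trans Ideal.span_singleton_one.symm) hI (by simp), idealClass_span]
    exact one_mem _
  obtain ⟨P, hPm, hIP⟩ := Ideal.exists_le_maximal I htop
  have hP0 : P ≠ ⊥ := by rintro rfl; exact hI (le_bot_iff.mp hIP)
  obtain ⟨Q, rfl⟩ := Ideal.dvd_iff_le.mpr hIP
  have hQ0 : Q ≠ ⊥ := right_ne_zero_of_mul hI
  have hPone : 1 < Ideal.absNorm P := by
    have h1 := absNorm_pos hP0
    have h2 : Ideal.absNorm P ≠ 1 := by
      rw [Ne, Ideal.absNorm_eq_one_iff]; exact hPm.ne_top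
    omega
  have hQpos := absNorm_pos hQ0
  rw [map_mul] at hN
  rw [c.bar_mul] at h
  by_cases hbar : c.bar P = P
  · rw [hbar] at h
    rw [idealClass_mul hP0 hQ0]
    refine mul_mem ?_ (ih _ ?_ Q hQ0 (mul_left_cancel₀ hP0 h) rfl)
    · rcases c.prime_of_bar_eq hPm.isPrime hP0 hbar with h1 | h1
      · rw [h1]; exact one_mem _
      · exact idealClass_mem_closure_of_absNorm_dvd _ _ _ (h1.trans (Dvd.intro_left _ rfl))
    · nlinarith
  · have hbP : Prime (c.bar P) := by
      rw [Ideal.prime_iff_isPrime (c.bar_ne_bot hP0)]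
      exact Ideal.map_isPrime_of_equiv c.τ
    have hdvd : c.bar P ∣ P * Q := ⟨c.bar Q, h.symm⟩
    have hndvd : ¬ c.bar P ∣ P := by
      intro h1
      rw [Ideal.dvd_iff_le] at h1
      exact hbar (hPm.eq_of_le (Ideal.isPrime_of_prime hbP).ne_top h1).symm
    obtain ⟨R, rfl⟩ := (hbP.dvd_or_dvd hdvd).resolve_left hndvd
    have hR0 : R ≠ ⊥ := right_ne_zero_of_mul hQ0
    have hPP : P * c.bar P ≠ ⊥ := mul_ne_zero hP0 hbP.ne_zero
    have h' : (P * c.bar P) * c.bar R = (P * c.bar P) * R := by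
      rw [c.bar_mul, c.bar_bar] at h
      rw [mul_assoc P (c.bar P) R, ← h]; ring
    have hspan : Ideal.span {((Ideal.absNorm P : ℕ) : 𝓞 K)} ≠ ⊥ := by rwa [← c.mul_bar P]
    have hcl : idealClass (P * (c.bar P * R)) hI = idealClass R hR0 := by
      rw [idealClass_congr (mul_assoc P (c.bar P) R).symm hI (mul_ne_zero hPP hR0),
        idealClass_mul hPP hR0, idealClass_congr (c.mul_bar P) hPP hspan, idealClass_span, one_mul]
    rw [hcl]
    refine ih _ ?_ R hR0 (mul_left_cancel₀ hPP h') rfl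
    have hRpos := absNorm_pos hR0
    rw [map_mul, c.absNorm_bar] at hN
    nlinarith [mul_pos hRpos (Nat.sub_pos_of_lt hPone), Nat.mul_le_mul hPone.le hPone.le]

theorem mem_of_sq_eq_one (c : ConjData σ) (n : ℤ) (k : ClassGroup (𝓞 K)) (hk : k ^ 2 = 1) :
    k ∈ Subgroup.closure (primeClasses K (n * discr K)) := by
  obtain ⟨I, hI, rfl⟩ := exists_idealClass_eq k
  have h : idealClass I hI = idealClass (c.bar I) (c.bar_ne_bot hI) := by
    rw [c.idealClass_bar hI, eq_inv_iff_mul_eq_one, ← sq, hk]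
  obtain ⟨x, y, hx, hy, hxy⟩ := (idealClass_eq_iff _ _).mp h
  by_cases hsum : x + y = 0
  · have hyx : y = -x := by linear_combination hsum
    rw [hyx, Ideal.span_singleton_neg] at hxy
    have hx' : Ideal.span {x} ≠ ⊥ := by simpa using hx
    exact c.idealClass_mem_of_bar_eq n I hI (mul_left_cancel₀ hx' hxy).symm
  have hN : x * c.τ x = y * c.τ y := by
    have h1 := congrArg Ideal.absNorm hxy
    rw [map_mul, map_mul, c.absNorm_bar] at h1
    have h2 := Nat.eq_of_mul_eq_mul_right (absNorm_pos hI) h1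
    have h3 : Algebra.norm ℤ x = Algebra.norm ℤ y := by
      rw [← c.absNorm_span, ← c.absNorm_span, h2]
    rw [← c.norm_eq, ← c.norm_eq, h3]
  have hw : c.τ y * (x + y) ≠ 0 := mul_ne_zero (c.τ_ne_zero hy) hsum
  have hw' : Ideal.span {c.τ y * (x + y)} ≠ ⊥ := by simpa using hw
  have hWI : Ideal.span {c.τ y * (x + y)} * I ≠ ⊥ := mul_ne_zero hw' hI
  have hcl : idealClass I hI = idealClass _ hWI := by
    rw [idealClass_mul hw' hI, idealClass_span, one_mul]
  rw [hcl]
  refine c.idealClass_mem_of_bar_eq n _ hWI ?_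
  rw [c.bar_mul, c.bar_span_singleton, map_mul, c.τ_τ, map_add, mul_comm y,
    ← Ideal.span_singleton_mul_span_singleton, mul_assoc, ← hxy, ← mul_assoc,
    Ideal.span_singleton_mul_span_singleton]
  congr 3
  linear_combination hN

/-- Two ideals of norm `n` have classes whose product is a square of a class of a divisor. -/
theorem mul_bar_sup {E F : Ideal (𝓞 K)} (h : Ideal.absNorm E = Ideal.absNorm F) :
    E * c.bar (E ⊔ F) = (E ⊔ F) * c.bar F := by
  rw [c.bar_sup, Ideal.mul_sup, Ideal.sup_mul, c.mul_bar E, c.mul_bar F, h, sup_comm]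

theorem closure_primeClasses_eq_top (c : ConjData σ) {n : ℕ}
    (h : ∀ k : ClassGroup (𝓞 K), ∃ E, ∃ hE : E ≠ ⊥, idealClass E hE = k ^ 2 ∧
      Ideal.absNorm E = n) :
    Subgroup.closure (primeClasses K (n * discr K)) = ⊤ := by
  rw [eq_top_iff]
  intro k _
  obtain ⟨E, hE, hEk, hEn⟩ := h k
  obtain ⟨F, hF, hFk, hFn⟩ := h 1
  have hG : E ⊔ F ≠ ⊥ := fun h0 => hE (le_bot_iff.mp (h0 ▸ le_sup_left))
  have h1 := c.mul_bar_sup (hEn.trans hFn.symm)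
  have h2 := idealClass_congr h1 (mul_ne_zero hE (c.bar_ne_bot hG))
    (mul_ne_zero hG (c.bar_ne_bot hF))
  rw [idealClass_mul hE (c.bar_ne_bot hG), idealClass_mul hG (c.bar_ne_bot hF), c.idealClass_bar hG,
    c.idealClass_bar hF, hEk, hFk, one_pow, inv_one, mul_one] at h2
  have hGmem : idealClass _ hG ∈ Subgroup.closure (primeClasses K (n * discr K)) := by
    apply idealClass_mem_closure_of_absNorm_dvd
    have h3 : Ideal.absNorm (E ⊔ F) ∣ Ideal.absNorm E := Ideal.absNorm_dvd_absNorm_of_le le_sup_left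
    rw [hEn] at h3
    exact (Int.natCast_dvd_natCast.mpr h3).trans (Dvd.intro _ rfl)
  set g := idealClass _ hG
  have h4 : (k * g⁻¹) ^ 2 = 1 := by
    rw [mul_pow, inv_pow, sq g, mul_inv, ← mul_assoc, h2, mul_inv_cancel]
  have h5 := mul_mem (c.mem_of_sq_eq_one n _ h4) hGmem
  rwa [inv_mul_cancel_right] at h5

theorem exists_sq_of_norm_eq (c : ConjData σ) {I : Ideal (𝓞 K)} (hI : I ≠ ⊥) {u : 𝓞 K} {z : ℤ} (hz : z ≠ 0)
    (h : Algebra.norm ℤ u = Ideal.absNorm I * z ^ 2) :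
    ∃ k, idealClass I hI = k ^ 2 := by
  have huu : u * c.τ u = ((Ideal.absNorm I : ℕ) : 𝓞 K) * (z : 𝓞 K) ^ 2 := by
    rw [← c.norm_eq, h]; push_cast; rfl
  have hz' : (z : 𝓞 K) ≠ 0 := by exact_mod_cast hz
  have hu : u ≠ 0 := by
    rintro rfl
    rw [zero_mul] at huu
    exact mul_ne_zero (absNorm_cast_ne_zero hI) (pow_ne_zero 2 hz') huu.symm
  have hu' : Ideal.span {c.τ u} ≠ ⊥ := by simpa using hu
  have hzI : Ideal.span {(z : 𝓞 K)} ≠ ⊥ := by simpa using hz'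
  set J := Ideal.span {u} ⊔ Ideal.span {(z : 𝓞 K)} * I with hJdef
  have hJ : J ≠ ⊥ := fun h0 => hu (by
    have : Ideal.span {u} ≤ ⊥ := h0 ▸ le_sup_left
    simpa using this)
  have key : Ideal.span {(z : 𝓞 K)} * I * c.bar J = Ideal.span {c.τ u} * J := by
    have h1 : Ideal.span {(z : 𝓞 K)} * I * (Ideal.span {(z : 𝓞 K)} * c.bar I) =
        Ideal.span {c.τ u} * Ideal.span {u} := by
      rw [mul_mul_mul_comm, c.mul_bar, Ideal.span_singleton_mul_span_singleton,
        Ideal.span_singleton_mul_span_singleton, Ideal.span_singleton_mul_span_singleton]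
      congr 2
      linear_combination -huu
    rw [hJdef, c.bar_sup, c.bar_mul, c.bar_span_singleton, c.bar_span_singleton, c.τ_intCast,
      Ideal.mul_sup, Ideal.mul_sup, h1, sup_comm, mul_comm _ (Ideal.span {c.τ u})]
  refine ⟨idealClass J hJ, ?_⟩
  have h2 := idealClass_congr key (mul_ne_zero (mul_ne_zero hzI hI) (c.bar_ne_bot hJ))
    (mul_ne_zero hu' hJ)
  rw [idealClass_mul (mul_ne_zero hzI hI) (c.bar_ne_bot hJ), idealClass_mul hzI hI,
    idealClass_mul hu' hJ, idealClass_span, idealClass_span, one_mul, one_mul,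
    c.idealClass_bar hJ, mul_inv_eq_iff_eq_mul, ← sq] at h2
  exact h2

/-- A rational isotropic vector of an integral Hermitian form yields an integral ideal. -/
theorem exists_ideal_of_isotropic {n : ℕ} (hn : n ≠ 0) {a α : 𝓞 K} {s t m : ℤ} (hm : m ≠ 0)
    (hdet : a * c.τ a + c.δ ^ 2 * s * t = n)
    (hiso : t * c.δ * (α * c.τ α) - m * (c.τ α * a - α * c.τ a) + s * c.δ * m ^ 2 = 0)
    {J : Ideal (𝓞 K)} (hJ : J ≠ ⊥) (hJspan : J = Ideal.span {(m : 𝓞 K), α}) :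
    ∃ E, ∃ hE : E ≠ ⊥, idealClass E hE = (idealClass J hJ)⁻¹ ^ 2 ∧ Ideal.absNorm E = n := by
  set A : 𝓞 K := t * c.δ * α - a * m with hA
  set B : 𝓞 K := c.τ a * α + s * c.δ * m with hB
  have hm' : (m : 𝓞 K) ≠ 0 := by exact_mod_cast hm
  have hAB : c.τ α * A + m * B = 0 := by rw [hA, hB]; linear_combination hiso
  have hτA : c.τ A = -(t * c.δ * c.τ α) - c.τ a * m := by
    rw [hA]; simp only [map_sub, map_mul, τ_δ, τ_intCast]; ring
  have hAA : A * c.τ A = n * m ^ 2 := by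
    have h1 : t * c.δ * B - c.τ a * A = n * m := by
      rw [hA, hB]; linear_combination (m : 𝓞 K) * hdet
    rw [hτA]
    linear_combination (m : 𝓞 K) * h1 - t * c.δ * hAB
  have hnK : (n : 𝓞 K) ≠ 0 := by exact_mod_cast hn
  have hA0 : A ≠ 0 := by
    intro h0
    rw [h0, zero_mul] at hAA
    exact mul_ne_zero hnK (pow_ne_zero 2 hm') hAA.symm
  have hle : Ideal.span {A, B} ≤ J := by
    rw [Ideal.span_le, hJspan]
    have h1 : (m : 𝓞 K) ∈ Ideal.span {(m : 𝓞 K), α} := Ideal.subset_span (by simp)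
    have h2 : α ∈ Ideal.span {(m : 𝓞 K), α} := Ideal.subset_span (by simp)
    rintro x (rfl | rfl)
    · exact Ideal.sub_mem _ (Ideal.mul_mem_left _ _ h2) (Ideal.mul_mem_left _ _ h1)
    · exact Ideal.add_mem _ (Ideal.mul_mem_left _ _ h2) (Ideal.mul_mem_left _ _ h1)
  obtain ⟨E, hE⟩ := Ideal.dvd_iff_le.mpr hle
  have hABne : Ideal.span {A, B} ≠ ⊥ := fun h0 => hA0 (by
    have : A ∈ Ideal.span {A, B} := Ideal.subset_span (by simp)
    rw [h0] at this
    simpa using this)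
  have hE0 : E ≠ ⊥ := right_ne_zero_of_mul (hE ▸ hABne)
  have hAs : Ideal.span {A} ≠ ⊥ := by simpa using hA0
  have hms : Ideal.span {(m : 𝓞 K)} ≠ ⊥ := by simpa using hm'
  have key : Ideal.span {A} * c.bar J = Ideal.span {(m : 𝓞 K)} * (J * E) := by
    rw [← hE, hJspan, c.bar_span, Set.image_pair, c.τ_intCast, Ideal.span_insert,
      Ideal.span_insert A, Ideal.mul_sup, Ideal.mul_sup]
    simp only [Ideal.span_singleton_mul_span_singleton]
    have h1 : A * c.τ α = -(m * B) := by linear_combination hAB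
    rw [h1, Ideal.span_singleton_neg, mul_comm A]
  refine ⟨E, hE0, ?_, ?_⟩
  · have h2 := idealClass_congr key (mul_ne_zero hAs (c.bar_ne_bot hJ))
      (mul_ne_zero hms (mul_ne_zero hJ hE0))
    rw [idealClass_mul hAs (c.bar_ne_bot hJ), idealClass_mul hms (mul_ne_zero hJ hE0),
      idealClass_mul hJ hE0, idealClass_span, idealClass_span, one_mul, one_mul,
      c.idealClass_bar hJ] at h2
    rw [sq]
    nth_rw 2 [h2]
    rw [inv_mul_cancel_left]
  · have h3 := congrArg (fun I => ((Ideal.absNorm I : ℕ) : ℤ)) key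
    simp only [map_mul, c.absNorm_bar, Nat.cast_mul, c.absNorm_span] at h3
    have h4 : Algebra.norm ℤ A = n * m ^ 2 := by
      have := c.norm_eq A
      rw [hAA] at this
      exact_mod_cast this
    have h5 : Algebra.norm ℤ (m : 𝓞 K) = m ^ 2 := by
      have := c.norm_eq (m : 𝓞 K)
      rw [c.τ_intCast, ← sq] at this
      exact_mod_cast this
    rw [h4, h5] at h3
    have h6 : ((Ideal.absNorm J : ℕ) : ℤ) * m ^ 2 ≠ 0 :=
      mul_ne_zero (by exact_mod_cast (absNorm_pos hJ).ne') (pow_ne_zero 2 hm)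
    have h7 : ((Ideal.absNorm E : ℕ) : ℤ) = n := by
      apply mul_left_cancel₀ h6
      linear_combination -h3
    exact_mod_cast h7

end ConjData

end Classes

section Minkowski

open MeasureTheory

/-- Minkowski's theorem for a subgroup of finite index of `ℤ^ι`. -/
theorem exists_mem_of_index_mul_two_pow_lt {ι : Type*} [Fintype ι] (L : AddSubgroup (ι → ℤ))
    (hL : L.index ≠ 0) {S : Set (ι → ℝ)} (h_symm : ∀ x ∈ S, -x ∈ S) (h_conv : Convex ℝ S)
    (h : (L.index : ENNReal) * 2 ^ Fintype.card ι < volume S) :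
    ∃ v ∈ L, v ≠ 0 ∧ (fun i => (v i : ℝ)) ∈ S := by
  classical
  let f : (ι → ℤ) →+ (ι → ℝ) := (Int.castAddHom ℝ).compLeft ι
  have hf : ∀ v i, f v i = (v i : ℝ) := fun v i => rfl
  have hinj : Function.Injective f := by
    intro v w hvw
    ext i
    have := congrFun hvw i
    rw [hf, hf] at this
    exact_mod_cast this
  let L₁ : Submodule ℤ (ι → ℝ) := (L.map f).toIntSubmodule
  let L₂ : Submodule ℤ (ι → ℝ) := Submodule.span ℤ (Set.range (Pi.basisFun ℝ ι))
  have hL₂ : L₂.toAddSubgroup = (⊤ : AddSubgroup (ι → ℤ)).map f := by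
    ext x
    rw [Submodule.mem_toAddSubgroup, Module.Basis.mem_span_iff_repr_mem]
    simp only [Pi.basisFun_repr, AddSubgroup.mem_map, AddSubgroup.mem_top, true_and]
    constructor
    · intro hx
      choose v hv using hx
      exact ⟨v, funext fun i => by rw [hf, ← hv i]; rfl⟩
    · rintro ⟨v, rfl⟩ i
      exact ⟨v i, rfl⟩
  have hle : L₁ ≤ L₂ := by
    intro x hx
    rw [← Submodule.mem_toAddSubgroup, hL₂]
    exact AddSubgroup.map_mono le_top hx
  have : DiscreteTopology L₁ := DiscreteTopology.of_subset (s := (L₂ : Set (ι → ℝ)))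
    (inferInstanceAs (DiscreteTopology L₂)) hle
  have : IsZLattice ℝ L₁ := by
    refine ⟨?_⟩
    rw [eq_top_iff, ← (Pi.basisFun ℝ ι).span_eq, Submodule.span_le]
    rintro _ ⟨i, rfl⟩
    have h1 : f (L.index • Pi.single i 1) ∈ L₁ := ⟨_, L.nsmul_index_mem _, rfl⟩
    have h2 : (Pi.basisFun ℝ ι) i = (L.index : ℝ)⁻¹ • f (L.index • Pi.single i 1) := by
      ext j
      have : (L.index : ℝ) ≠ 0 := by exact_mod_cast hL
      rw [Pi.smul_apply, hf, Pi.basisFun_apply]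
      by_cases hij : j = i
      · subst hij; simp [this]
      · simp [hij]
    rw [h2]
    exact Submodule.smul_mem _ _ (Submodule.subset_span h1)
  have hcov₂ : ZLattice.covolume L₂ = 1 := by
    rw [ZLattice.covolume_eq_measure_fundamentalDomain L₂ volume
      (ZSpan.isAddFundamentalDomain (Pi.basisFun ℝ ι) volume), ZSpan.fundamentalDomain_pi_basisFun,
      Measure.real, volume_pi, Measure.pi_pi]
    simp
  have hcov₁ : ZLattice.covolume L₁ = L.index := by
    have h1 := ZLattice.covolume_div_covolume_eq_relIndex L₁ L₂ hle
    rw [hcov₂, div_one, hL₂] at h1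
    rw [h1, ← AddSubgroup.relIndex_top_right, ← AddSubgroup.relIndex_map_map_of_injective L ⊤ hinj]
    rfl
  have fund := ZLattice.isAddFundamentalDomain (IsZLattice.basis L₁) (volume : Measure (ι → ℝ))
  set F := ZSpan.fundamentalDomain ((IsZLattice.basis L₁).ofZLatticeBasis ℝ L₁)
  have hF : volume F = L.index := by
    have h1 := ZLattice.covolume_eq_measure_fundamentalDomain L₁ volume fund
    rw [hcov₁, Measure.real] at h1
    have h2 : (volume F).toReal ≠ 0 := by rw [← h1]; exact_mod_cast hL
    rw [← ENNReal.ofReal_toReal (a := volume F) (fun h3 => h2 (by rw [h3]; rfl)), ← h1,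
      ENNReal.ofReal_natCast]
  have : Countable L₁.toAddSubgroup := by
    have : Countable (Set.range f) := (Set.countable_range f).to_subtype
    refine (Set.Countable.mono ?_ (Set.countable_range f)).to_subtype
    rintro _ ⟨v, _, rfl⟩
    exact ⟨v, rfl⟩
  obtain ⟨x, hx0, hxS⟩ := exists_ne_zero_mem_lattice_of_measure_mul_two_pow_lt_measure
    (L := L₁.toAddSubgroup) (F := F) (μ := volume) fund h_symm h_conv
    (by rwa [hF, Module.finrank_fintype_fun_eq_card])
  obtain ⟨v, hv, hvx⟩ := x.2
  refine ⟨v, hv, ?_, ?_⟩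
  · rintro rfl
    exact hx0 (Subtype.ext (by rw [← hvx, map_zero]; rfl))
  · rw [← hvx] at hxS
    exact hxS

theorem volume_cylinder (R h : ℝ) :
    volume {v : Fin 3 → ℝ | ‖(v 0 : ℂ) + v 1 * Complex.I‖ < R ∧ |v 2| < h} =
      ENNReal.ofReal R ^ 2 * NNReal.pi * ENNReal.ofReal (2 * h) := by
  have h1 : {v : Fin 3 → ℝ | ‖(v 0 : ℂ) + v 1 * Complex.I‖ < R ∧ |v 2| < h} =
      MeasurableEquiv.piFinSuccAbove (fun _ => ℝ) 2 ⁻¹'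
        (Set.Ioo (-h) h ×ˢ (Complex.measurableEquivPi.symm ⁻¹' Metric.ball 0 R)) := by
    ext v
    simp only [Set.mem_ofPred_eq, Set.mem_preimage, Set.mem_prod, Set.mem_Ioo, mem_ball_zero_iff,
      Complex.measurableEquivPi_symm_apply]
    rw [and_comm, abs_lt]
    rfl
  rw [h1, (volume_preserving_piFinSuccAbove (fun _ : Fin 3 => ℝ) 2).measure_preimage_equiv,
    Measure.volume_eq_prod, Measure.prod_prod,
    (Complex.volume_preserving_equiv_pi.symm _).measure_preimage_equiv, Complex.volume_ball,
    Real.volume_Ioo, mul_comm]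
  congr 2
  ring

theorem exists_mem_cylinder (L : AddSubgroup (Fin 3 → ℤ)) (hL : L.index ≠ 0) (e₀ e₁ : ℂ) {R h : ℝ}
    (hR : 0 < R) (hh : 0 < h) (hd : e₀.re * e₁.im - e₁.re * e₀.im ≠ 0)
    (hvol : 4 * L.index * |e₀.re * e₁.im - e₁.re * e₀.im| < Real.pi * R ^ 2 * h) :
    ∃ v ∈ L, v ≠ 0 ∧ ‖(v 0 : ℂ) * e₀ + v 1 * e₁‖ < R ∧ |(v 2 : ℝ)| < h := by
  set d := e₀.re * e₁.im - e₁.re * e₀.im with hddef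
  let A : Matrix (Fin 3) (Fin 3) ℝ := !![e₀.re, e₁.re, 0; e₀.im, e₁.im, 0; 0, 0, 1]
  have hdet : LinearMap.det (Matrix.toLin' A) = d := by
    rw [LinearMap.det_toLin', Matrix.det_fin_three, hddef]
    simp [A]
  let S : Set (Fin 3 → ℝ) := {v | ‖(v 0 : ℂ) * e₀ + v 1 * e₁‖ < R ∧ |v 2| < h}
  have hS : S = Matrix.toLin' A ⁻¹' {v | ‖(v 0 : ℂ) + v 1 * Complex.I‖ < R ∧ |v 2| < h} := by
    ext v
    have h0 : Matrix.toLin' A v 0 = e₀.re * v 0 + e₁.re * v 1 := by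
      simp [A, Matrix.toLin'_apply, Matrix.mulVec, dotProduct, Fin.sum_univ_three]
    have h1 : Matrix.toLin' A v 1 = e₀.im * v 0 + e₁.im * v 1 := by
      simp [A, Matrix.toLin'_apply, Matrix.mulVec, dotProduct, Fin.sum_univ_three]
    have h2 : Matrix.toLin' A v 2 = v 2 := by
      simp [A, Matrix.toLin'_apply, Matrix.mulVec, dotProduct, Fin.sum_univ_three]
    have h3 : ((Matrix.toLin' A v 0 : ℝ) : ℂ) + (Matrix.toLin' A v 1 : ℝ) * Complex.I =
        (v 0 : ℂ) * e₀ + v 1 * e₁ := by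
      rw [h0, h1]
      apply Complex.ext <;> simp <;> ring
    simp only [S, Set.mem_ofPred_eq, Set.mem_preimage]
    rw [h3, h2]
  have hvolS : volume S = ENNReal.ofReal (|d|⁻¹ * (R ^ 2 * Real.pi * (2 * h))) := by
    rw [hS, Measure.addHaar_preimage_linearMap _ (by rwa [hdet]), hdet, volume_cylinder,
      abs_inv, ENNReal.ofReal_mul (p := |d|⁻¹) (by positivity), ENNReal.ofReal_mul (p := R ^ 2 * Real.pi) (by positivity),
      ENNReal.ofReal_mul (p := R ^ 2) (by positivity), ENNReal.ofReal_pow hR.le]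
    congr 3
    exact (ENNReal.ofReal_coe_nnreal (p := NNReal.pi)).symm
  have hsymm : ∀ x ∈ S, -x ∈ S := by
    rintro x ⟨h1, h2⟩
    refine ⟨?_, by simpa using h2⟩
    have h3 : ((-x) 0 : ℂ) * e₀ + (-x) 1 * e₁ = -((x 0 : ℂ) * e₀ + x 1 * e₁) := by
      rw [Pi.neg_apply, Pi.neg_apply, Complex.ofReal_neg, Complex.ofReal_neg]
      ring
    rw [h3, norm_neg]
    exact h1
  have hconv : Convex ℝ S := by
    have h1 : S = (fun v : Fin 3 → ℝ => (v 0 : ℂ) * e₀ + v 1 * e₁) ⁻¹' Metric.ball 0 R ∩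
        (fun v : Fin 3 → ℝ => v 2) ⁻¹' Metric.ball 0 h := by
      ext v
      simp [S]
    rw [h1]
    refine Convex.inter ((convex_ball _ _).is_linear_preimage ⟨?_, ?_⟩)
      ((convex_ball _ _).is_linear_preimage ⟨?_, ?_⟩)
    · intro x y; simp only [Pi.add_apply, Complex.ofReal_add]; ring
    · intro r x
      simp only [Pi.smul_apply, smul_eq_mul, Complex.ofReal_mul, Complex.real_smul]; ring
    · intro x y; rfl
    · intro r x; rfl
  obtain ⟨v, hv, hv0, hvS⟩ := exists_mem_of_index_mul_two_pow_lt L hL hsymm hconv (by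
    rw [hvolS, Fintype.card_fin,
      show (L.index : ENNReal) * 2 ^ 3 = ENNReal.ofReal (L.index * 2 ^ 3) by
        rw [ENNReal.ofReal_mul (by positivity), ENNReal.ofReal_natCast,
          ENNReal.ofReal_pow (by norm_num)]
        simp]
    have hd' : 0 < |d| := abs_pos.mpr hd
    have hpi := Real.pi_pos
    rw [ENNReal.ofReal_lt_ofReal_iff (by positivity), inv_mul_eq_div, lt_div_iff₀ hd']
    linarith)
  exact ⟨v, hv, hv0, by simpa [S] using hvS⟩

end Minkowski

section PrincipalGenus

variable {K : Type*} [Field K] [NumberField K] {σ : K →+* ℂ}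

namespace ConjData

/-- An ideal norm prime to the discriminant and congruent to a norm modulo the discriminant is,
up to a square, the norm of an integer. -/
theorem exists_norm_eq_absNorm_mul_sq (c : ConjData σ) (hquad : Module.finrank ℚ K = 2)
    {I : Ideal (𝓞 K)} (hI : I ≠ ⊥) (hcop : IsCoprime (Ideal.absNorm I : ℤ) (discr K)) {x : 𝓞 K}
    (hx : (Ideal.absNorm I : ℤ) ≡ Algebra.norm ℤ x [ZMOD discr K]) :
    ∃ (u : 𝓞 K) (z : ℤ), z ≠ 0 ∧ Algebra.norm ℤ u = Ideal.absNorm I * z ^ 2 := by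
  set N := Ideal.absNorm I with hN
  have hNpos : 0 < N := absNorm_pos hI
  have hneg := c.discr_neg
  have hrank : Module.finrank ℤ (𝓞 K) = 2 := by rw [RingOfIntegers.rank, hquad]
  let b := Module.finBasisOfFinrankEq ℤ (𝓞 K) hrank
  have hspan : Ideal.span {c.δ} ≠ ⊥ := by simpa using c.δ_ne_zero
  let P : Ideal (𝓞 K) := Ideal.span {c.δ}
  have hPnorm : (Ideal.absNorm P : ℤ) = -discr K := by rw [c.absNorm_span, c.norm_δ]
  let g : (Fin 3 → ℤ) →+ 𝓞 K :=
    { toFun := fun v => v 0 * b 0 + v 1 * b 1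
      map_zero' := by simp
      map_add' := fun v w => by simp only [Pi.add_apply, Int.cast_add]; ring }
  let g' : (Fin 3 → ℤ) →+ 𝓞 K :=
    { toFun := fun v => v 0 * b 0 + v 1 * b 1 - v 2 * x
      map_zero' := by simp
      map_add' := fun v w => by simp only [Pi.add_apply, Int.cast_add]; ring }
  let φ : (Fin 3 → ℤ) →+ (𝓞 K ⧸ I) × (𝓞 K ⧸ P) :=
    ((Ideal.Quotient.mk I).toAddMonoidHom.comp g).prod
      ((Ideal.Quotient.mk P).toAddMonoidHom.comp g')
  have hcard : Nat.card ((𝓞 K ⧸ I) × (𝓞 K ⧸ P)) = N * Ideal.absNorm P := by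
    rw [Nat.card_prod]; rfl
  have hPpos : 0 < Ideal.absNorm P := absNorm_pos hspan
  have : Finite ((𝓞 K ⧸ I) × (𝓞 K ⧸ P)) :=
    Nat.finite_of_card_ne_zero (by rw [hcard]; positivity)
  have hidx : φ.ker.index ≤ N * Ideal.absNorm P := by
    rw [AddSubgroup.index_ker, ← hcard]
    exact Nat.card_le_card_of_injective _ Subtype.val_injective
  have hidx0 : φ.ker.index ≠ 0 := by
    rw [AddSubgroup.index_ker]
    exact Nat.card_ne_zero.mpr ⟨inferInstance, inferInstance⟩
  have hlat : ∀ v ∈ φ.ker, (N : ℤ) * discr K ∣ Algebra.norm ℤ (g v) - N * v 2 ^ 2 := by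
    intro v hv
    have h1 : φ v = 0 := hv
    have hgI : g v ∈ I := Ideal.Quotient.eq_zero_iff_mem.mp (congrArg Prod.fst h1)
    have hgP : g v - v 2 * x ∈ P := Ideal.Quotient.eq_zero_iff_mem.mp (congrArg Prod.snd h1)
    apply hcop.mul_dvd
    · exact dvd_sub (Ideal.absNorm_dvd_norm_of_mem hgI) (Dvd.intro _ rfl)
    · obtain ⟨w, hw⟩ := Ideal.mem_span_singleton'.mp hgP
      obtain ⟨k, hk⟩ := c.sub_conj (w * c.τ (v 2 * x))
      rw [map_mul c.τ w, c.τ_τ] at hk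
      have h2 : Algebra.norm ℤ (g v) - Algebra.norm ℤ x * v 2 ^ 2 =
          discr K * (k - Algebra.norm ℤ w) := by
        have h3 : ((Algebra.norm ℤ (g v) : ℤ) : 𝓞 K) -
            ((Algebra.norm ℤ x : ℤ) : 𝓞 K) * (v 2 : 𝓞 K) ^ 2 =
            ((discr K : ℤ) : 𝓞 K) * (k - ((Algebra.norm ℤ w : ℤ) : 𝓞 K)) := by
          have h4 : g v = w * c.δ + v 2 * x := by rw [hw]; ring
          rw [c.norm_eq, c.norm_eq, c.norm_eq, ← c.δ_sq, h4]
          simp only [map_add, map_mul, τ_δ, c.τ_intCast] at hk ⊢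
          linear_combination c.δ * hk
        exact_mod_cast h3
      obtain ⟨j, hj⟩ := hx.dvd
      refine ⟨(k - Algebra.norm ℤ w) + j * v 2 ^ 2, ?_⟩
      linear_combination h2 + (v 2) ^ 2 * hj
  have hdisc := c.discr_basis b
  set e₀ : ℂ := σ (b 0)
  set e₁ : ℂ := σ (b 1)
  have hd2 : 4 * (e₀.re * e₁.im - e₁.re * e₀.im) ^ 2 = -(discr K : ℝ) := by
    have h1 := congrArg (fun y : 𝓞 K => (σ y).re) hdisc
    simp only [map_pow, map_sub, map_mul, c.map_τ, map_intCast, Complex.intCast_re] at h1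
    rw [← h1, sq (_ - _ : ℂ)]
    simp [Complex.mul_re, Complex.mul_im]
    ring
  set d := e₀.re * e₁.im - e₁.re * e₀.im
  have hnegR := c.discr_neg_real
  have hd : d ≠ 0 := by
    intro h0
    rw [h0] at hd2
    linarith
  have hdabs : |d| = Real.sqrt (-(discr K : ℝ)) / 2 := by
    rw [← hd2, show (4 : ℝ) * d ^ 2 = (2 * d) ^ 2 by ring, Real.sqrt_sq_eq_abs, abs_mul]
    norm_num
  have hsqrt : 0 < Real.sqrt (-(discr K : ℝ)) := Real.sqrt_pos.mpr (by linarith)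
  have hNR : (0 : ℝ) < N := by exact_mod_cast hNpos
  have hPR : (Ideal.absNorm P : ℝ) = -(discr K : ℝ) := by exact_mod_cast hPnorm
  have hNP : (0 : ℝ) < N * -(discr K : ℝ) := mul_pos hNR (by linarith)
  obtain ⟨v, hv, hv0, hvR, hvh⟩ := exists_mem_cylinder φ.ker hidx0 e₀ e₁
    (R := Real.sqrt (N * -(discr K : ℝ))) (h := Real.sqrt (-(discr K : ℝ)))
    (Real.sqrt_pos.mpr hNP) hsqrt hd (by
      have h1 : (φ.ker.index : ℝ) ≤ N * -(discr K : ℝ) := by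
        rw [← hPR]; exact_mod_cast hidx
      rw [hdabs, Real.sq_sqrt hNP.le]
      have h2 := Real.pi_gt_three
      have h3 : (φ.ker.index : ℝ) * Real.sqrt (-(discr K : ℝ)) ≤
        N * -(discr K : ℝ) * Real.sqrt (-(discr K : ℝ)) := mul_le_mul_of_nonneg_right h1 hsqrt.le
      have h4 : 0 < N * -(discr K : ℝ) * Real.sqrt (-(discr K : ℝ)) := mul_pos hNP hsqrt
      nlinarith)
  have hnorm : ((Algebra.norm ℤ (g v) : ℤ) : ℝ) = ‖(v 0 : ℂ) * e₀ + v 1 * e₁‖ ^ 2 := by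
    rw [c.norm_eq_normSq, Complex.normSq_eq_norm_sq]
    congr 2
    simp [g, e₀, e₁]
  have hlt1 : ((Algebra.norm ℤ (g v) : ℤ) : ℝ) < N * -(discr K : ℝ) := by
    rw [hnorm, ← Real.lt_sqrt (_root_.norm_nonneg _)]
    exact hvR
  have hlt2 : (v 2 : ℝ) ^ 2 < -(discr K : ℝ) := by
    rw [← sq_abs, ← Real.lt_sqrt (abs_nonneg _)]
    exact hvh
  have hlt1' : Algebra.norm ℤ (g v) < N * -discr K := by exact_mod_cast hlt1
  have hlt2' : v 2 ^ 2 < -discr K := by exact_mod_cast hlt2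
  have hNZ : (0 : ℤ) < N := by exact_mod_cast hNpos
  have hnn := c.norm_nonneg (g v)
  have hzero : Algebra.norm ℤ (g v) - N * v 2 ^ 2 = 0 := by
    have h1 : (N : ℤ) * -discr K ∣ Algebra.norm ℤ (g v) - N * v 2 ^ 2 := by
      rw [mul_neg, neg_dvd]
      exact hlat v hv
    refine Int.eq_zero_of_abs_lt_dvd h1 (abs_lt.mpr ⟨?_, ?_⟩)
    · have := mul_lt_mul_of_pos_left hlt2' hNZ
      linarith
    · have : 0 ≤ (N : ℤ) * v 2 ^ 2 := by positivity
      linarith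
  refine ⟨g v, v 2, ?_, by linarith⟩
  intro h2
  rw [h2] at hzero
  have h3 : Algebra.norm ℤ (g v) = 0 := by simpa using hzero
  rw [Algebra.norm_eq_zero_iff] at h3
  have h4 : v 0 • b 0 + v 1 • b 1 = 0 := by
    rw [zsmul_eq_mul, zsmul_eq_mul]
    exact h3
  have h5 := Fintype.linearIndependent_iff.mp b.linearIndependent (fun i => v i.castSucc) (by
    rw [Fin.sum_univ_two]; exact h4)
  apply hv0
  ext i
  fin_cases i
  · exact h5 0
  · exact h5 1
  · exact h2

theorem exists_sq_of_mem_principalGenus (c : ConjData σ) (hquad : Module.finrank ℚ K = 2)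
    {k : ClassGroup (𝓞 K)} (hk : k ∈ principalGenus K) : ∃ j, k = j ^ 2 := by
  obtain ⟨I, rfl, hcop, x, hx⟩ := hk
  have hI : (I : Ideal (𝓞 K)) ≠ ⊥ := nonZeroDivisors.coe_ne_zero I
  obtain ⟨u, z, hz, h⟩ := c.exists_norm_eq_absNorm_mul_sq hquad hI hcop hx
  exact c.exists_sq_of_norm_eq hI hz h

end ConjData

end PrincipalGenus

section Geometry

namespace OrientedCircle

/-- The circle translated by `-z` and then inverted has curvature `C.form z 1` and
curvature-center the conjugate of this. -/
def shiftCenter (C : OrientedCircle) (z : ℂ) : ℂ := C.r * z - C.ζ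

theorem normSq_shiftCenter (C : OrientedCircle) (z : ℂ) :
    Complex.normSq (C.shiftCenter z) - C.form z 1 * C.r = 1 := by
  rw [← C.unit]
  simp only [shiftCenter, form, Complex.normSq_apply, Complex.sub_re, Complex.sub_im,
    Complex.mul_re, Complex.mul_im, Complex.ofReal_re, Complex.ofReal_im, Complex.conj_re,
    Complex.conj_im, Complex.one_re, Complex.one_im]
  ring

theorem form_one_zero (C : OrientedCircle) : C.form 1 0 = C.r := by
  simp [form]

theorem normSq_form_add (C : OrientedCircle) (z w : ℂ) (h : C.form w 1 = 0) :
    Complex.normSq (C.form z 1 + conj (w - z) * C.shiftCenter z) = Complex.normSq (w - z) := by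
  have h1 := C.normSq_shiftCenter z
  have h2 : Complex.normSq (C.form z 1 + conj (w - z) * C.shiftCenter z) =
      Complex.normSq (w - z) * (Complex.normSq (C.shiftCenter z) - C.form z 1 * C.r) +
        C.form z 1 * C.form w 1 := by
    simp only [shiftCenter, form, Complex.normSq_apply, Complex.sub_re, Complex.sub_im,
      Complex.mul_re, Complex.mul_im, Complex.ofReal_re, Complex.ofReal_im, Complex.conj_re,
      Complex.conj_im, Complex.one_re, Complex.one_im, Complex.add_re, Complex.add_im]
    ring
  rw [h2, h1, h]
  ring

theorem exists_norm_add_eq (z : ℂ) (X : OnePoint ℂ) : ∃ ω : ℂ, ∀ C : OrientedCircle,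
    C.form z 1 ≠ 0 → X ∈ C.points → ‖ω + C.shiftCenter z / C.form z 1‖ = |C.form z 1|⁻¹ := by
  induction X using OnePoint.rec with
  | infty =>
    refine ⟨0, fun C hC hX => ?_⟩
    rcases hX with ⟨w, hw, -⟩ | ⟨-, h⟩
    · exact absurd hw (OnePoint.infty_ne_coe w)
    rw [form_one_zero] at h
    have h1 := C.normSq_shiftCenter z
    rw [h, mul_zero, sub_zero, Complex.normSq_eq_norm_sq] at h1
    have h2 : ‖C.shiftCenter z‖ = 1 := by
      exact (pow_eq_one_iff_of_nonneg (norm_nonneg _) two_ne_zero).mp h1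
    rw [zero_add, norm_div, h2, Complex.norm_real, Real.norm_eq_abs, one_div]
  | coe w =>
    refine ⟨(conj (w - z))⁻¹, fun C hC hX => ?_⟩
    rcases hX with ⟨w', hw, h⟩ | ⟨hw, -⟩
    swap
    · exact absurd hw (OnePoint.coe_ne_infty w)
    obtain rfl := OnePoint.coe_injective hw
    have hne : w - z ≠ 0 := by
      intro h0
      rw [sub_eq_zero] at h0
      rw [h0] at h
      exact hC h
    have hne' : conj (w - z) ≠ 0 := (map_ne_zero _).mpr hne
    have hC' : (C.form z 1 : ℂ) ≠ 0 := by exact_mod_cast hC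
    have h1 := C.normSq_form_add z w h
    rw [Complex.normSq_eq_norm_sq, Complex.normSq_eq_norm_sq,
      sq_eq_sq₀ (norm_nonneg _) (norm_nonneg _)] at h1
    have h2 : (conj (w - z))⁻¹ + C.shiftCenter z / C.form z 1 =
        (C.form z 1 + conj (w - z) * C.shiftCenter z) / (conj (w - z) * C.form z 1) := by
      field_simp
    rw [h2, norm_div, norm_mul, h1, Complex.norm_conj, Complex.norm_real, Real.norm_eq_abs]
    have h3 : ‖w - z‖ ≠ 0 := by simpa using hne
    field_simp

/-- Meeting circles are close to each other after an inversion centered at `z`. -/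
theorem norm_sub_le_of_meet {C C' : OrientedCircle} {z : ℂ} {μ : ℝ} (hμ : 0 < μ)
    (hC : μ ≤ |C.form z 1|) (hC' : μ ≤ |C'.form z 1|) (h : (C.points ∩ C'.points).Nonempty) :
    ‖C'.shiftCenter z / C'.form z 1 - C.shiftCenter z / C.form z 1‖ ≤ 2 * μ⁻¹ := by
  obtain ⟨X, hX, hX'⟩ := h
  obtain ⟨ω, hω⟩ := exists_norm_add_eq z X
  have h1 := hω C (abs_pos.mp (hμ.trans_le hC)) hX
  have h2 := hω C' (abs_pos.mp (hμ.trans_le hC')) hX'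
  have h3 : C'.shiftCenter z / C'.form z 1 - C.shiftCenter z / C.form z 1 =
    (ω + C'.shiftCenter z / C'.form z 1) - (ω + C.shiftCenter z / C.form z 1) := by ring
  rw [h3]
  refine (norm_sub_le _ _).trans ?_
  rw [h1, h2, two_mul]
  exact add_le_add (inv_anti₀ hμ hC') (inv_anti₀ hμ hC)

theorem norm_sub_le_of_chain {z : ℂ} {μ : ℝ} (hμ : 0 < μ) {n : ℕ}
    (c : Fin (n + 1) → OrientedCircle) (hc : ∀ k, μ ≤ |(c k).form z 1|)
    (hmeet : ∀ k : Fin n, ((c k.castSucc).points ∩ (c k.succ).points).Nonempty) :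
    ‖(c (Fin.last n)).shiftCenter z / (c (Fin.last n)).form z 1 -
      (c 0).shiftCenter z / (c 0).form z 1‖ ≤ 2 * n * μ⁻¹ := by
  induction n with
  | zero => simp
  | succ n ih =>
    have h1 := ih (fun k => c k.castSucc) (fun k => hc _) (fun k => hmeet k.castSucc)
    have h2 := norm_sub_le_of_meet hμ (hc _) (hc _) (hmeet (Fin.last n))
    rw [Fin.succ_last] at h2
    have h3 := norm_add_le_of_le h1 h2
    rw [Fin.castSucc_zero] at h3
    rw [add_comm, sub_add_sub_cancel] at h3
    refine h3.trans (le_of_eq ?_)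
    push_cast
    ring

/-- A chain which starts far from `z`, after inversion, cannot halve the curvature. -/
theorem half_lt_of_chain {z : ℂ} {μ : ℝ} (hμ : 0 < μ) {n : ℕ}
    (c : Fin (n + 1) → OrientedCircle) (hc : ∀ k, μ ≤ |(c k).form z 1|)
    (hmeet : ∀ k : Fin n, ((c k.castSucc).points ∩ (c k.succ).points).Nonempty)
    (h0 : |(c 0).form z 1| = μ) (hfar : 8 * n + 4 ≤ ‖(c 0).shiftCenter z‖) :
    |(c 0).r| / 2 < |(c (Fin.last n)).r| := by
  have h1 := norm_sub_le_of_chain hμ c hc hmeet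
  set C := c 0
  set C' := c (Fin.last n)
  have hC' : μ ≤ |C'.form z 1| := hc _
  set X := ‖C.shiftCenter z‖ with hX
  set Y := ‖C'.shiftCenter z‖ with hY
  set p' := |C'.form z 1| with hp'
  have hp'0 : 0 < p' := hμ.trans_le hC'
  have h2 : X / μ - Y / p' ≤ 2 * n * μ⁻¹ := by
    have h3 := norm_sub_norm_le (C.shiftCenter z / C.form z 1) (C'.shiftCenter z / C'.form z 1)
    rw [norm_sub_rev] at h3
    rw [norm_div, norm_div, Complex.norm_real, Complex.norm_real, Real.norm_eq_abs,
      Real.norm_eq_abs, h0] at h3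
    exact h3.trans h1
  have e1 := C.normSq_shiftCenter z
  have e2 := C'.normSq_shiftCenter z
  rw [Complex.normSq_eq_norm_sq] at e1 e2
  have hn : (0 : ℝ) ≤ n := Nat.cast_nonneg n
  have h3 : X ^ 2 - 1 = μ * |C.r| := by
    have : C.form z 1 * C.r = X ^ 2 - 1 := by linarith
    rw [← h0, ← abs_mul, this, abs_of_nonneg]
    nlinarith
  have h4 : Y ^ 2 - 1 ≤ p' * |C'.r| := by
    have : C'.form z 1 * C'.r = Y ^ 2 - 1 := by linarith
    rw [hp', ← abs_mul, this]
    exact le_abs_self _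
  have h5 : p' * (X - 2 * n) ≤ μ * Y := by
    have h6 : X / μ - 2 * n * μ⁻¹ = (X - 2 * n) / μ := by field_simp
    have h7 : (X - 2 * n) / μ ≤ Y / p' := by rw [← h6]; linarith
    rw [div_le_div_iff₀ hμ hp'0] at h7
    linarith
  have hW : 3 / 4 * X + 1 ≤ X - 2 * n := by linarith
  set W := X - 2 * n
  have hW0 : 0 < W := by nlinarith
  have hYW : p' ^ 2 * W ^ 2 ≤ μ ^ 2 * Y ^ 2 := by
    rw [← mul_pow, ← mul_pow]
    exact pow_le_pow_left₀ (by positivity) h5 2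
  have h8 : μ ^ 2 * (W ^ 2 - 1) ≤ μ ^ 2 * (μ * |C'.r|) := by
    have a1 : p' ^ 2 * W ^ 2 - μ ^ 2 ≤ μ ^ 2 * (p' * |C'.r|) := by nlinarith [sq_nonneg μ]
    have a2 : μ ^ 2 ≤ p' ^ 2 := pow_le_pow_left₀ hμ.le hC' 2
    have a3 : p' ^ 2 * (W ^ 2 - 1) ≤ μ ^ 2 * (p' * |C'.r|) := by nlinarith
    have a4 : p' * (W ^ 2 - 1) ≤ μ ^ 2 * |C'.r| := by
      have : p' * (p' * (W ^ 2 - 1)) ≤ p' * (μ ^ 2 * |C'.r|) := by nlinarith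
      exact le_of_mul_le_mul_left this hp'0
    have a5 : 0 ≤ W ^ 2 - 1 := by nlinarith
    have a6 : μ * (W ^ 2 - 1) ≤ μ ^ 2 * |C'.r| :=
      (mul_le_mul_of_nonneg_right hC' a5).trans a4
    nlinarith
  have h9 := le_of_mul_le_mul_left h8 (by positivity)
  have h10 : μ * (|C.r| / 2) < μ * |C'.r| := by
    have : μ * (|C.r| / 2) = (X ^ 2 - 1) / 2 := by rw [h3]; ring
    rw [this]
    nlinarith
  exact lt_of_mul_lt_mul_left h10 hμ.le

end OrientedCircle

end Geometry

section Arrangement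

variable {K : Type*} [Field K] [NumberField K] {σ : K →+* ℂ}

/-- The integral coordinates of a circle of `S_D`. -/
structure HasCoords (σ : K →+* ℂ) (D : ℝ) (C : OrientedCircle) (a : 𝓞 K) (s t : ℤ) : Prop where
  ζ_eq : Complex.I * (Real.sqrt D : ℂ) * C.ζ = σ a
  rhat_eq : Real.sqrt D * C.rhat = Real.sqrt (-(discr K : ℝ)) * s
  r_eq : Real.sqrt D * C.r = Real.sqrt (-(discr K : ℝ)) * t

namespace ConjData

theorem mem_arrangement_iff (c : ConjData σ) {D : ℝ} {C : OrientedCircle} :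
    C ∈ arrangement σ D ↔ ∃ a s t, HasCoords σ D C a s t := by
  have key : ∀ (x : ℝ) (s : ℤ), Complex.I * (Real.sqrt D : ℂ) * x = sqrtDiscr K * s ↔
      Real.sqrt D * x = Real.sqrt (-(discr K : ℝ)) * s := by
    intro x s
    rw [sqrtDiscr, mul_assoc, mul_assoc, mul_right_inj' Complex.I_ne_zero]
    constructor
    · intro h; exact_mod_cast h
    · intro h; exact_mod_cast h
  constructor
  · rintro ⟨⟨a, ha⟩, -, ⟨s, hs⟩, ⟨t, ht⟩⟩
    exact ⟨a, s, t, ha, (key _ _).mp hs, (key _ _).mp ht⟩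
  · rintro ⟨a, s, t, h⟩
    refine ⟨⟨a, h.ζ_eq⟩, ⟨-c.τ a, ?_⟩, ⟨s, (key _ _).mpr h.rhat_eq⟩, ⟨t, (key _ _).mpr h.r_eq⟩⟩
    have h1 := congrArg conj h.ζ_eq
    rw [← c.map_τ] at h1
    simp only [map_mul, Complex.conj_I, Complex.conj_ofReal] at h1
    have h2 : σ ((-c.τ a : 𝓞 K) : K) = -σ (c.τ a) := by simp
    rw [h2, ← h1]
    simp [OrientedCircle.vec]

theorem sqrtDiscr_real_sq (c : ConjData σ) :
    Real.sqrt (-(discr K : ℝ)) ^ 2 = -(discr K : ℝ) :=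
  Real.sq_sqrt (by linarith [c.discr_neg_real])

theorem sqrtDiscr_real_pos (c : ConjData σ) : 0 < Real.sqrt (-(discr K : ℝ)) :=
  Real.sqrt_pos.mpr (by linarith [c.discr_neg_real])

theorem det_eq (c : ConjData σ) {D : ℝ} (hD : 0 < D) {C : OrientedCircle} {a : 𝓞 K} {s t : ℤ}
    (h : HasCoords σ D C a s t) : D = ((Algebra.norm ℤ a + discr K * s * t : ℤ) : ℝ) := by
  have hsq := Real.sq_sqrt hD.le
  have h1 := congrArg Complex.normSq h.ζ_eq
  rw [map_mul, map_mul, Complex.normSq_I, one_mul, Complex.normSq_ofReal, ← c.norm_eq_normSq] at h1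
  have h2 := c.sqrtDiscr_real_sq
  push_cast
  rw [← h1]
  linear_combination (-Complex.normSq C.ζ) * hsq - D * C.unit + C.rhat * C.r * hsq
    - Real.sqrt D * C.r * h.rhat_eq - Real.sqrt (-(discr K : ℝ)) * s * h.r_eq
    - s * t * h2

/-- The value of the form of a circle of `S_D` at a point of `K`. -/
theorem form_eq (c : ConjData σ) {D : ℝ} {C : OrientedCircle} {a : 𝓞 K} {s t : ℤ}
    (h : HasCoords σ D C a s t) (α : 𝓞 K) {m : ℤ} (hm : m ≠ 0) :
    ∃ P : ℤ, Real.sqrt D * C.form (σ α / m) 1 * m ^ 2 = Real.sqrt (-(discr K : ℝ)) * P ∧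
      t * c.δ * (α * c.τ α) - m * (c.τ α * a - α * c.τ a) + s * c.δ * m ^ 2 = P * c.δ := by
  obtain ⟨k, hk⟩ := c.sub_conj (c.τ α * a)
  rw [map_mul, c.τ_τ] at hk
  refine ⟨t * Algebra.norm ℤ α + s * m ^ 2 - m * k, ?_, ?_⟩
  · have hm' : (m : ℝ) ≠ 0 := by exact_mod_cast hm
    have hre : 2 * Real.sqrt D * (conj (σ α) * C.ζ).re = Real.sqrt (-(discr K : ℝ)) * k := by
      have h1 := congrArg (fun y : 𝓞 K => (σ y).im) hk
      simp only [map_sub, map_mul, c.map_τ, map_intCast, c.map_δ, ← h.ζ_eq] at h1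
      simp [sqrtDiscr] at h1 ⊢
      linarith
    have hform : C.form (σ α / m) 1 * m ^ 2 =
        C.r * Complex.normSq (σ α) - 2 * m * (conj (σ α) * C.ζ).re + C.rhat * m ^ 2 := by
      have h1 : conj (σ α / m) * 1 * C.ζ = ((m : ℝ)⁻¹ : ℝ) * (conj (σ α) * C.ζ) := by
        rw [map_div₀, map_intCast]
        push_cast
        field_simp
      rw [OrientedCircle.form, h1, Complex.re_ofReal_mul, map_div₀, map_one,
        ← Complex.ofReal_intCast m, Complex.normSq_ofReal]
      field_simp
    rw [mul_assoc, hform, ← c.norm_eq_normSq]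
    push_cast
    linear_combination (Algebra.norm ℤ α : ℝ) * h.r_eq + (m : ℝ) ^ 2 * h.rhat_eq - (m : ℝ) * hre
  · push_cast
    rw [c.norm_eq]
    linear_combination -(m : 𝓞 K) * hk

/-- Parabolic elements of `SL₂(𝓞)` which fix the point `α / m`, applied to a circle of `S_D`. -/
theorem exists_parabolic_shift (c : ConjData σ) {D : ℝ} {C : OrientedCircle}
    (hC : C ∈ arrangement σ D) (α : 𝓞 K) {m : ℤ} (hm : m ≠ 0) (k : ℤ) :
    ∃ C' ∈ arrangement σ D, C'.form (σ α / m) 1 = C.form (σ α / m) 1 ∧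
      C'.shiftCenter (σ α / m) =
        C.shiftCenter (σ α / m) + ((k * m ^ 3 : ℤ) : ℝ) * C.form (σ α / m) 1 := by
  obtain ⟨a, s, t, h⟩ := c.mem_arrangement_iff.mp hC
  obtain ⟨P, hP, -⟩ := c.form_eq h α hm
  obtain ⟨G, hG⟩ := c.sub_conj (t * c.δ * α - m * a)
  set X : 𝓞 K := t * c.δ * α - m * a with hX
  set z : ℂ := σ α / m with hz
  set p := C.form z 1 with hp
  set q := C.shiftCenter z with hq
  set M : ℝ := (m : ℝ) with hM
  have hm' : (m : ℂ) ≠ 0 := by exact_mod_cast hm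
  have hzm : z * m = σ α := by rw [hz]; field_simp
  have hz1 : Complex.normSq z * M ^ 2 = Algebra.norm ℤ α := by
    rw [c.norm_eq_normSq, ← hzm, map_mul, ← Complex.ofReal_intCast m, Complex.normSq_ofReal]
    ring
  set A : ℤ := Algebra.norm ℤ (1 + α) - 1 - Algebra.norm ℤ α with hA
  have hz2 : 2 * z.re * M = A := by
    have h1 : (σ α).re = z.re * M := by
      rw [← hzm, ← Complex.ofReal_intCast m, Complex.re_mul_ofReal]
    have h2 : (A : ℝ) = 2 * (σ α).re := by
      rw [hA]
      push_cast
      rw [c.norm_eq_normSq, c.norm_eq_normSq]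
      simp [Complex.normSq_apply]
      ring
    rw [h2, h1]
    ring
  have hGr : Real.sqrt D * (2 * q.re) * M = Real.sqrt (-(discr K : ℝ)) * G := by
    have h1 : σ X = Complex.I * (Real.sqrt D : ℂ) * q * m := by
      have h2 : (Real.sqrt D : ℂ) * C.r = (Real.sqrt (-(discr K : ℝ)) : ℂ) * t := by
        exact_mod_cast h.r_eq
      simp only [hX, map_sub, map_mul, map_intCast, c.map_δ, ← h.ζ_eq, hq, OrientedCircle.shiftCenter,
        sqrtDiscr]
      rw [← hzm]
      linear_combination (-Complex.I * z * m) * h2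
    have h3 : σ ((X - c.τ X : 𝓞 K) : K) = σ X - conj (σ X) := by
      rw [← c.map_τ, ← map_sub σ]; rfl
    rw [hG, h1] at h3
    have h4 := congrArg Complex.im h3
    simp [c.map_δ, sqrtDiscr] at h4
    linarith
  set κ : ℝ := ((k * m ^ 3 : ℤ) : ℝ) with hκ
  set dr : ℝ := 2 * κ * q.re + κ ^ 2 * p with hdr
  let C' : OrientedCircle :=
    { ζ := C.ζ + dr * z - κ * p
      r := C.r + dr
      rhat := C.rhat + dr * Complex.normSq z - 2 * κ * p * z.re
      unit := by
        rw [← C.unit, hdr, hq, hp]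
        simp only [OrientedCircle.shiftCenter, OrientedCircle.form, Complex.normSq_apply,
          Complex.sub_re, Complex.sub_im, Complex.mul_re, Complex.mul_im, Complex.ofReal_re,
          Complex.ofReal_im, Complex.conj_re, Complex.conj_im, Complex.one_re, Complex.one_im,
          Complex.add_re, Complex.add_im]
        ring }
  refine ⟨C', ?_, ?_, ?_⟩
  · rw [c.mem_arrangement_iff]
    refine ⟨a + c.δ * α * ((k * m * G + k ^ 2 * m ^ 3 * P : ℤ) : 𝓞 K)
      - ((k * m * P : ℤ) : 𝓞 K) * c.δ,
      s + (k * G + k ^ 2 * m ^ 2 * P) * Algebra.norm ℤ α - k * P * A,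
      t + k * m ^ 2 * G + k ^ 2 * m ^ 4 * P, ?_, ?_, ?_⟩
    · have hGc : (Real.sqrt D : ℂ) * (2 * q.re) * m = (Real.sqrt (-(discr K : ℝ)) : ℂ) * G := by
        rw [← Complex.ofReal_intCast m]
        exact_mod_cast hGr
      have hPc : (Real.sqrt D : ℂ) * p * m ^ 2 = (Real.sqrt (-(discr K : ℝ)) : ℂ) * P := by
        rw [← Complex.ofReal_intCast m, ← hM]
        exact_mod_cast hP
      simp only [C', hdr, hκ]
      simp only [map_add, map_sub, map_mul, map_intCast, c.map_δ, ← h.ζ_eq, ← hzm, sqrtDiscr]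
      push_cast
      linear_combination (Complex.I * k * m ^ 2 * z) * hGc +
        (Complex.I * (k ^ 2 * m ^ 4 * z - k * m)) * hPc
    · simp only [C', hdr, hκ]
      push_cast
      linear_combination h.rhat_eq + k * Complex.normSq z * M ^ 2 * hGr
        + k ^ 2 * M ^ 4 * Complex.normSq z * hP - k * 2 * z.re * M * hP
        + (Real.sqrt (-(discr K : ℝ)) * (k * G + k ^ 2 * M ^ 2 * P)) * hz1
        - (Real.sqrt (-(discr K : ℝ)) * k * P) * hz2
    · simp only [C', hdr, hκ]
      push_cast
      linear_combination h.r_eq + k * M ^ 2 * hGr + k ^ 2 * M ^ 4 * hP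
  · rw [hp]
    simp only [C', OrientedCircle.form, Complex.normSq_apply,
          Complex.sub_re, Complex.sub_im, Complex.mul_re, Complex.mul_im, Complex.ofReal_re,
          Complex.ofReal_im, Complex.conj_re, Complex.conj_im, Complex.one_re, Complex.one_im,
          Complex.add_re, Complex.add_im]
    ring
  · rw [hq]
    simp only [C', OrientedCircle.shiftCenter]
    push_cast
    ring

end ConjData

end Arrangement

section Covering

variable {K : Type*} [Field K] [NumberField K] {σ : K →+* ℂ}

namespace ConjData

theorem covers_infty (c : ConjData σ) {D : ℝ} (hD : 0 < D) (hne : (arrangement σ D).Nonempty)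
    (hfin : FinitelyConnected (arrangement σ D)) : Covers (arrangement σ D) OnePoint.infty := by
  by_contra hcov
  have hr : ∀ C ∈ arrangement σ D, C.r ≠ 0 := fun C hC h0 =>
    hcov ⟨C, hC, Or.inr ⟨rfl, by rw [OrientedCircle.form_one_zero, h0]⟩⟩
  have hs := c.sqrtDiscr_real_pos
  have hD' := Real.sqrt_pos.mpr hD
  obtain ⟨C, hC, hmin⟩ : ∃ C ∈ arrangement σ D, ∀ C' ∈ arrangement σ D, |C.r| ≤ |C'.r| := by
    have hex : ∃ N : ℕ, ∃ C, ∃ a s t, HasCoords σ D C a s t ∧ t.natAbs = N := by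
      obtain ⟨C, hC⟩ := hne
      obtain ⟨a, s, t, h⟩ := c.mem_arrangement_iff.mp hC
      exact ⟨_, C, a, s, t, h, rfl⟩
    classical
    obtain ⟨C, a, s, t, h, ht⟩ := Nat.find_spec hex
    refine ⟨C, c.mem_arrangement_iff.mpr ⟨a, s, t, h⟩, fun C' hC' => ?_⟩
    obtain ⟨a', s', t', h'⟩ := c.mem_arrangement_iff.mp hC'
    have h1 : t.natAbs ≤ t'.natAbs := ht.le.trans (Nat.find_min' hex ⟨C', a', s', t', h', rfl⟩)
    have h2 : |(t : ℝ)| ≤ |(t' : ℝ)| := by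
      rw [← Int.cast_abs, ← Int.cast_abs, Int.cast_le, Int.abs_eq_natAbs, Int.abs_eq_natAbs]
      exact_mod_cast h1
    have h3 := congrArg abs h.r_eq
    have h4 := congrArg abs h'.r_eq
    rw [abs_mul, abs_mul, abs_of_pos hs, abs_of_pos hD'] at h3 h4
    apply le_of_mul_le_mul_left _ hD'
    rw [h3, h4]
    exact mul_le_mul_of_nonneg_left h2 hs.le
  obtain ⟨n, hn⟩ := hfin
  obtain ⟨d, -, hd, -, hlast⟩ := hn C hC (hr C hC)
  have h1 := hmin _ (hd (Fin.last n))
  have h2 := abs_pos.mpr (hr C hC)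
  linarith

theorem covers_div (c : ConjData σ) {D : ℝ} (hD : 0 < D) (hne : (arrangement σ D).Nonempty)
    (hfin : FinitelyConnected (arrangement σ D)) (α : 𝓞 K) {m : ℤ} (hm : m ≠ 0) :
    Covers (arrangement σ D) ((σ α / m : ℂ) : OnePoint ℂ) := by
  by_contra hcov
  set z : ℂ := σ α / m with hz
  have hp : ∀ C ∈ arrangement σ D, C.form z 1 ≠ 0 := fun C hC h0 =>
    hcov ⟨C, hC, Or.inl ⟨z, rfl, h0⟩⟩
  have hs := c.sqrtDiscr_real_pos
  have hD' := Real.sqrt_pos.mpr hD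
  have hm2 : (0 : ℝ) < (m : ℝ) ^ 2 := by positivity
  obtain ⟨C, hC, hmin⟩ : ∃ C ∈ arrangement σ D, ∀ C' ∈ arrangement σ D,
      |C.form z 1| ≤ |C'.form z 1| := by
    have hex : ∃ N : ℕ, ∃ C ∈ arrangement σ D, ∃ P : ℤ,
        Real.sqrt D * C.form z 1 * m ^ 2 = Real.sqrt (-(discr K : ℝ)) * P ∧ P.natAbs = N := by
      obtain ⟨C, hC⟩ := hne
      obtain ⟨a, s, t, h⟩ := c.mem_arrangement_iff.mp hC
      obtain ⟨P, hP, -⟩ := c.form_eq h α hm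
      exact ⟨_, C, hC, P, hP, rfl⟩
    classical
    obtain ⟨C, hC, P, hP, hPN⟩ := Nat.find_spec hex
    refine ⟨C, hC, fun C' hC' => ?_⟩
    obtain ⟨a, s, t, h⟩ := c.mem_arrangement_iff.mp hC'
    obtain ⟨P', hP', -⟩ := c.form_eq h α hm
    have h1 : P.natAbs ≤ P'.natAbs := hPN.le.trans (Nat.find_min' hex ⟨C', hC', P', hP', rfl⟩)
    have h2 : |(P : ℝ)| ≤ |(P' : ℝ)| := by
      rw [← Int.cast_abs, ← Int.cast_abs, Int.cast_le, Int.abs_eq_natAbs, Int.abs_eq_natAbs]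
      exact_mod_cast h1
    have h3 := congrArg abs hP
    have h4 := congrArg abs hP'
    rw [abs_mul, abs_mul, abs_mul, abs_of_pos hs, abs_of_pos hD', abs_of_pos hm2] at h3 h4
    refine le_of_mul_le_mul_left (le_of_mul_le_mul_right ?_ hm2) hD'
    rw [h3, h4]
    exact mul_le_mul_of_nonneg_left h2 hs.le
  set μ := |C.form z 1| with hμdef
  have hμ : 0 < μ := abs_pos.mpr (hp C hC)
  obtain ⟨n, hn⟩ := hfin
  obtain ⟨k, hk⟩ := exists_nat_gt ((8 * n + 4 + ‖C.shiftCenter z‖) / μ)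
  obtain ⟨C', hC', hform, hcenter⟩ := c.exists_parabolic_shift hC α hm k
  rw [← hz] at hform hcenter
  have hfar : 8 * n + 4 ≤ ‖C'.shiftCenter z‖ := by
    rw [div_lt_iff₀ hμ] at hk
    have h1 : (1 : ℝ) ≤ |(m : ℝ) ^ 3| := by
      have : (1 : ℤ) ≤ |m ^ 3| := Int.one_le_abs (pow_ne_zero 3 hm)
      exact_mod_cast this
    have h2 : (k : ℝ) * μ ≤ ‖(((((k : ℤ) * m ^ 3 : ℤ) : ℝ) : ℂ)) * C.form z 1‖ := by
      rw [norm_mul, Complex.norm_real, Complex.norm_real, Real.norm_eq_abs, Real.norm_eq_abs]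
      push_cast
      rw [abs_mul, Nat.abs_cast]
      have : (k : ℝ) ≤ k * |(m : ℝ) ^ 3| := le_mul_of_one_le_right (Nat.cast_nonneg k) h1
      exact mul_le_mul_of_nonneg_right this hμ.le
    have h3 := norm_sub_le_norm_add
      ((((((k : ℤ) * m ^ 3 : ℤ) : ℝ) : ℂ)) * C.form z 1) (C.shiftCenter z)
    rw [add_comm (_ * _) (C.shiftCenter z), ← hcenter] at h3
    linarith
  have hr0 : C'.r ≠ 0 := by
    intro h0
    have h1 := C'.normSq_shiftCenter z
    rw [h0, mul_zero, sub_zero, Complex.normSq_eq_norm_sq] at h1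
    have hn0 : (0 : ℝ) ≤ n := Nat.cast_nonneg n
    nlinarith
  obtain ⟨d, hd0, hd, hmeet, hlast⟩ := hn C' hC' hr0
  have h1 := OrientedCircle.half_lt_of_chain hμ d (fun k => hmin _ (hd k)) hmeet
    (by rw [hd0, hform]) (by rw [hd0]; exact hfar)
  rw [hd0] at h1
  linarith

theorem exists_ideal_of_covers (c : ConjData σ) {D : ℝ} {n : ℕ} (hn : n ≠ 0) (hnD : (n : ℝ) = D)
    (hcov : ∀ (α : 𝓞 K) (m : ℤ), m ≠ 0 →
      Covers (arrangement σ D) ((σ α / m : ℂ) : OnePoint ℂ)) (k : ClassGroup (𝓞 K)) :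
    ∃ E, ∃ hE : E ≠ ⊥, idealClass E hE = k ^ 2 ∧ Ideal.absNorm E = n := by
  obtain ⟨J, hJ, hJk⟩ := exists_idealClass_eq k⁻¹
  have hm : ((Ideal.absNorm J : ℕ) : ℤ) ≠ 0 := by exact_mod_cast (absNorm_pos hJ).ne'
  obtain ⟨α, hα⟩ := IsDedekindDomain.exists_eq_span_pair (Ideal.absNorm_mem J)
    (absNorm_cast_ne_zero hJ)
  obtain ⟨C, hC, hz⟩ := hcov α _ hm
  obtain ⟨a, s, t, h⟩ := c.mem_arrangement_iff.mp hC
  obtain ⟨P, hP, hPiso⟩ := c.form_eq h α hm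
  have hform : C.form (σ α / ((Ideal.absNorm J : ℕ) : ℤ)) 1 = 0 := by
    rcases hz with ⟨w, hw, h0⟩ | ⟨hw, -⟩
    · rw [OnePoint.coe_injective hw]
      exact h0
    · exact absurd hw (OnePoint.coe_ne_infty _)
  have hP0 : P = 0 := by
    rw [hform, mul_zero, zero_mul, eq_comm, mul_eq_zero] at hP
    exact_mod_cast hP.resolve_left c.sqrtDiscr_real_pos.ne'
  rw [hP0, Int.cast_zero, zero_mul] at hPiso
  have hD : 0 < D := by rw [← hnD]; exact_mod_cast Nat.pos_of_ne_zero hn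
  have hdet : a * c.τ a + c.δ ^ 2 * s * t = n := by
    have h1 := c.det_eq hD h
    rw [← hnD] at h1
    have h2 : (n : ℤ) = Algebra.norm ℤ a + discr K * s * t := by exact_mod_cast h1
    rw [← c.norm_eq, c.δ_sq]
    exact_mod_cast congrArg (fun i : ℤ => (i : 𝓞 K)) h2.symm
  have h3 := c.exists_ideal_of_isotropic hn hm hdet hPiso hJ (by rw [Int.cast_natCast]; exact hα)
  rwa [hJk, inv_inv] at h3

end ConjData

end Covering

theorem theorem5p13 {K : Type*} [Field K] [NumberField K]
    (hquad : Module.finrank ℚ K = 2) (himag : NumberField.IsTotallyComplex K)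
    (σ : K →+* ℂ) (D : ℝ) (hD : 0 < D)
    (hne : (arrangement σ D).Nonempty)
    (hfin : FinitelyConnected (arrangement σ D)) :
    (∀ x ∈ extendedField σ, Covers (arrangement σ D) x) ∧
    ∃ n : ℕ, (n : ℝ) = D ∧
      Subgroup.closure (primeClasses K (n * NumberField.discr K)) = ⊤ ∧
      ∀ c ∈ principalGenus K, ∃ I : (Ideal (NumberField.RingOfIntegers K))⁰,
        ClassGroup.mk0 I = c ∧ Ideal.absNorm (I : Ideal (NumberField.RingOfIntegers K)) = n := by
  obtain ⟨c⟩ := nonempty_conjData hquad himag σ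
  have hcov := fun (α : 𝓞 K) (m : ℤ) (hm : m ≠ 0) => c.covers_div hD hne hfin α hm
  refine ⟨?_, ?_⟩
  · rintro x (rfl | ⟨κ, rfl⟩)
    · exact c.covers_infty hD hne hfin
    · obtain ⟨x, y, hy, rfl⟩ := IsFractionRing.div_surjective (A := 𝓞 K) κ
      have hy0 : y ≠ 0 := nonZeroDivisors.ne_zero hy
      have hN : Algebra.norm ℤ y ≠ 0 := by rwa [Ne, Algebra.norm_eq_zero_iff]
      have hy1 : σ (algebraMap (𝓞 K) K y) ≠ 0 := by simpa using hy0
      have hy2 : conj (σ (algebraMap (𝓞 K) K y)) ≠ 0 := (map_ne_zero _).mpr hy1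
      have h1 : σ ((x * c.τ y : 𝓞 K) : K) / ((Algebra.norm ℤ y : ℤ) : ℂ) =
          σ (algebraMap (𝓞 K) K x / algebraMap (𝓞 K) K y) := by
        have h2 : ((Algebra.norm ℤ y : ℤ) : ℂ) = σ y * conj (σ y) := by
          rw [Complex.mul_conj, ← c.norm_eq_normSq, Complex.ofReal_intCast]
        have h4 : σ ((x * c.τ y : 𝓞 K) : K) = σ x * conj (σ y) := by
          rw [← c.map_τ, ← map_mul σ]; rfl
        rw [h2, h4, map_div₀]
        exact mul_div_mul_right _ _ hy2
      have h3 := hcov (x * c.τ y) _ hN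
      rwa [h1] at h3
  · obtain ⟨C, hC⟩ := hne
    obtain ⟨a, s, t, h⟩ := c.mem_arrangement_iff.mp hC
    have hdet := c.det_eq hD h
    obtain ⟨n, hn⟩ : ∃ n : ℕ, (n : ℤ) = Algebra.norm ℤ a + discr K * s * t := by
      refine ⟨_, Int.toNat_of_nonneg ?_⟩
      rw [hdet] at hD
      exact_mod_cast hD.le
    have hnD : (n : ℝ) = D := by rw [hdet, ← hn, Int.cast_natCast]
    have hn0 : n ≠ 0 := by
      rintro rfl
      rw [← hnD] at hD
      simp at hD
    have hsq := c.exists_ideal_of_covers hn0 hnD hcov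
    refine ⟨n, hnD, c.closure_primeClasses_eq_top hsq, fun k hk => ?_⟩
    obtain ⟨j, rfl⟩ := c.exists_sq_of_mem_principalGenus hquad hk
    obtain ⟨E, hE, hEj, hEn⟩ := hsq j
    exact ⟨⟨E, mem_nonZeroDivisors_of_ne_zero hE⟩, hEj, hEn⟩
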